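/- Theorem 4.1. Let $\mu$ be the Möbius function, let $\{t\}$ be the fractional part of $t$, and let $S(x)=\int_0^x \frac{\sin u}{u}\,du$ be the sine integral. For every real $a>0$, $$\int_{0}^{\infty}\frac{\{t\}}{t}\left(\sum_{n\ge1}\frac{\mu(n)}{n}e^{-t/(na)}\right)dt=-\frac{1}{2}+\frac{1}{\pi}\int_{0}^{\infty}S\!\left(\frac{x}{2\pi a}\right)e^{-x}\,dx.$$ Here the inner series is the limit of its partial sums $\sum_{n=1}^{N}$ as $N\to\infty$, which exists for every $t>0$, and both integrals over $(0,\infty)$ converge absolutely. -/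

import Mathlib

/-- The sine integral `Si(x) = ∫₀ˣ sin u / u du`. (The value of the integrand at the single point
`u = 0` does not affect the integral.) -/
noncomputable def sineIntegral (x : ℝ) : ℝ :=
  ∫ u in (0 : ℝ)..x, Real.sin u / u

/-- The partial sums `∑_{1 ≤ n ≤ N} (μ(n)/n) e^{-t/(n a)}`. The full series over `n ≥ 1` converges
only conditionally, so its sum is the limit of these as `N → ∞`. -/
noncomputable def mobiusExpPartialSum (a t : ℝ) (N : ℕ) : ℝ :=
  ∑ n ∈ Finset.Icc 1 N,
    ((ArithmeticFunction.moebius n : ℤ) : ℝ) / (n : ℝ) * Real.exp (-t / ((n : ℝ) * a))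

/-!
Write `m(x) = ∑_{n ≤ x} μ(n)/n`. Everything rests on `∫₁^∞ |m(x)|/x dx < ∞`
(`integrableOn_mobiusSum_div`), a form of the prime number theorem with just enough of a rate to
make all interchanges of sums and integrals absolutely convergent.

To prove it, note that `∫₁^∞ m(x) x^{-s-1} dx = 1/(s ζ(1+s))` for `re s > 0`. Differentiating in
`s` inserts a factor `-log x`, so Plancherel's theorem (`eLpNorm_fourier_eq`) on the lines
`re s = σ`, followed by `σ → 0⁺`, gives `∫₁^∞ |m(x) log x|² dx/x < ∞`, provided the derivative of
`1/(s ζ(1+s))` is bounded in `L²` uniformly in `σ`. The `L¹` statement follows from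
`|m| ≤ m² log² x + 1/log² x`. The derivative is `O(|t|^{-11/20})` at height `t`
(`exists_norm_deriv_inv_riemannZeta₁_le`): `ζ` and `ζ'` are `O(|t|^{1/20})` for `re s ≥ 1`, and
the inequality `ζ(σ)³ |ζ(σ+it)|⁴ |ζ(σ+2it)| ≥ 1` turns this into `|ζ(σ+it)| ≥ c |t|^{-1/5}`.

Since `m` oscillates slowly, integrability of `m(x)/x` forces `m(x) → 0` (`tendsto_mobiusSum`).
Summation by parts then shows that the inner series converges to
`Δ(t) = -∫₁^∞ m(x) (d/dx) e^{-t/(ax)} dx`, and by Fubini's theorem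
`∫₀^∞ ({t}/t) Δ(t) dt = -∫₁^∞ (m(x)/x) L(ax) dx` with `L(b) = b⁻¹ ∫₀^∞ {t} e^{-t/b} dt`.
The partial fractions of `coth` give `L(b) = 1/2 - ∑_{k ≥ 1} 2b/(1 + (2πkb)²)`. Undoing the
summation by parts in the `k`-th term yields
`∑_n (μ(n)/n) (πk)⁻¹ arctan(1/(2πkna))`, and since `∑_{n ∣ N} μ(n)` vanishes for `N > 1`, the sum
over `k` collapses to `π⁻¹ arctan(1/(2πa))`. Hence the integral equals
`-A/2 + π⁻¹ arctan(1/(2πa))` with `A = ∫₁^∞ m(x)/x dx`, and `a → 0⁺` shows `A = 1`. Finally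
`∫₀^∞ S(cx) e^{-x} dx = arctan c`.
-/

namespace MobiusExp
open MeasureTheory Filter Set Topology
open scoped FourierTransform SchwartzMap ENNReal

/-! ### Plancherel's theorem for integrable functions -/

lemma integral_fourier_mul_schwartz {f : ℝ → ℂ} (hf : Integrable f) (g : 𝓢(ℝ, ℂ)) :
    ∫ ξ, g ξ * 𝓕 f ξ = ∫ x, (𝓕 g) x * f x := by
  have h := VectorFourier.integral_fourierIntegral_smul_eq_flip (μ := volume) (ν := volume)
    (L := innerₗ ℝ) (F := ℂ) Real.continuous_fourierChar continuous_inner hf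
    (g.integrable (μ := volume))
  simp only [flip_innerₗ, smul_eq_mul] at h
  rw [SchwartzMap.fourier_coe]
  simp only [Real.fourier_eq, mul_comm (g _)]
  simpa only [VectorFourier.fourierIntegral, Real.fourier_eq, innerₗ_apply_apply, mul_comm (f _)] using! h

/-- **Plancherel's theorem** for an integrable function whose Fourier integral is square
integrable. -/
theorem eLpNorm_fourier_eq {f : ℝ → ℂ} (hf : Integrable f) (hf2 : MemLp f 2)
    (hF : MemLp (𝓕 f) 2) : eLpNorm (𝓕 f) 2 volume = eLpNorm f 2 volume := by
  have key : 𝓕 (hf2.toLp f) = hF.toLp (𝓕 f) := by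
    have hinj : Function.Injective (Lp.toTemperedDistributionCLM ℂ (volume : Measure ℝ) 2) :=
      LinearMap.ker_eq_bot.mp Lp.ker_toTemperedDistributionCLM_eq_bot
    apply hinj
    simp only [Lp.toTemperedDistributionCLM_apply]
    rw [← Lp.fourier_toTemperedDistribution_eq]
    ext g
    rw [TemperedDistribution.fourier_apply, Lp.toTemperedDistribution_apply,
      Lp.toTemperedDistribution_apply]
    simp only [smul_eq_mul]
    calc ∫ x, (𝓕 g) x * hf2.toLp f x = ∫ x, (𝓕 g) x * f x := by
          refine integral_congr_ae ?_
          filter_upwards [hf2.coeFn_toLp] with x hx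
          rw [hx]
      _ = ∫ ξ, g ξ * 𝓕 f ξ := (integral_fourier_mul_schwartz hf g).symm
      _ = _ := by
          refine integral_congr_ae ?_
          filter_upwards [hF.coeFn_toLp] with x hx
          rw [hx]
  have h := Lp.norm_fourier_eq (hf2.toLp f)
  rw [key, Lp.norm_toLp, Lp.norm_toLp] at h
  exact (ENNReal.toReal_eq_toReal_iff' hF.eLpNorm_ne_top hf2.eLpNorm_ne_top).mp h

/-! ### A bound for `ζ(s) - 1/(s-1)` to the left of `re s = 1` -/

/-- The `n`-th term `∫_{n+1}^{n+2} ((n+1)^{-s} - x^{-s}) dx` of the series for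
`ζ(s) - 1/(s-1)`. -/
noncomputable def zetaTerm (n : ℕ) (s : ℂ) : ℂ :=
  ((n + 1 : ℝ) : ℂ) ^ (-s) - ∫ x in (n + 1 : ℝ)..(n + 2), (x : ℂ) ^ (-s)

lemma zetaTerm_eq {s : ℂ} (hs : s ≠ 1) (n : ℕ) :
    zetaTerm n s = ((n + 1 : ℝ) : ℂ) ^ (-s) -
      (((n + 2 : ℝ) : ℂ) ^ (1 - s) - ((n + 1 : ℝ) : ℂ) ^ (1 - s)) / (1 - s) := by
  rw [zetaTerm, integral_cpow]
  · rw [show -s + 1 = 1 - s by ring]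
  · refine Or.inr ⟨fun h ↦ hs (neg_injective h), ?_⟩
    rw [uIcc_of_le (by linarith)]
    intro h
    have := h.1
    have : (0 : ℝ) ≤ n := n.cast_nonneg
    linarith [h.1]

lemma norm_cpow_neg_sub_le {s : ℂ} (hs : 0 ≤ s.re) {a x : ℝ} (ha : 0 < a) (hx : x ∈ Icc a (a + 1)) :
    ‖(a : ℂ) ^ (-s) - (x : ℂ) ^ (-s)‖ ≤ ‖s‖ * a ^ (-s.re - 1) := by
  have h := Convex.norm_image_sub_le_of_norm_hasDerivWithin_le
    (f := fun y : ℝ ↦ (y : ℂ) ^ (-s)) (f' := fun y : ℝ ↦ -s * (y : ℂ) ^ (-s - 1))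
    (s := Icc a (a + 1)) (x := a) (y := x) (C := ‖s‖ * a ^ (-s.re - 1)) ?_ ?_
    (convex_Icc _ _) ⟨le_rfl, by linarith⟩ hx
  · rw [norm_sub_rev]
    refine h.trans ?_
    have h1 : ‖x - a‖ ≤ 1 := by
      rw [Real.norm_eq_abs, abs_le]; constructor <;> linarith [hx.1, hx.2]
    exact mul_le_of_le_one_right (by positivity) h1
  · intro y hy
    have hy0 : 0 < y := ha.trans_le hy.1
    have h1 : HasDerivAt (fun z : ℂ ↦ z ^ (-s)) (-s * (y : ℂ) ^ (-s - 1)) (y : ℂ) := by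
      simpa using (hasDerivAt_id (y : ℂ)).cpow_const (c := -s) (Or.inl (by simpa using hy0))
    exact h1.comp_ofReal.hasDerivWithinAt
  · intro y hy
    have hy0 : 0 < y := ha.trans_le hy.1
    rw [norm_mul, norm_neg, Complex.norm_cpow_eq_rpow_re_of_pos hy0]
    refine mul_le_mul_of_nonneg_left ?_ (norm_nonneg _)
    simp only [Complex.sub_re, Complex.neg_re, Complex.one_re]
    exact Real.rpow_le_rpow_of_nonpos ha hy.1 (by linarith)

/-- Interpolating between the trivial bound and the mean value bound for
`(n+1)^{-s} - x^{-s}` gains an arbitrary fraction `θ` of the decay in `n` at the cost of only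
`‖s‖^θ`. -/
lemma norm_zetaTerm_le {s : ℂ} (hs : 0 ≤ s.re) {θ : ℝ} (h0 : 0 ≤ θ) (h1 : θ ≤ 1) (n : ℕ) :
    ‖zetaTerm n s‖ ≤ 2 * ‖s‖ ^ θ * (n + 1 : ℝ) ^ (-(s.re + θ)) := by
  set a : ℝ := n + 1 with ha
  have ha0 : 0 < a := by positivity
  have hcont : ContinuousOn (fun x : ℝ ↦ (x : ℂ) ^ (-s)) (uIcc a (a + 1)) := by
    intro x hx
    rw [uIcc_of_le (by linarith)] at hx
    exact (Complex.continuousAt_ofReal_cpow_const _ _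
      (Or.inr (ha0.trans_le hx.1).ne')).continuousWithinAt
  have heq : zetaTerm n s = ∫ x in a..(a + 1), ((a : ℂ) ^ (-s) - (x : ℂ) ^ (-s)) := by
    rw [intervalIntegral.integral_sub intervalIntegrable_const
      hcont.intervalIntegrable, zetaTerm]
    simp only [intervalIntegral.integral_const, add_sub_cancel_left, one_smul]
    rw [ha, show (n : ℝ) + 1 + 1 = n + 2 by ring]
  rw [heq]
  have hb : ∀ x ∈ uIoc a (a + 1), ‖(a : ℂ) ^ (-s) - (x : ℂ) ^ (-s)‖ ≤
      2 * ‖s‖ ^ θ * a ^ (-(s.re + θ)) := by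
    intro x hx
    rw [uIoc_of_le (by linarith)] at hx
    have hx0 : 0 < x := ha0.trans hx.1
    set y := ‖(a : ℂ) ^ (-s) - (x : ℂ) ^ (-s)‖ with hy
    have hB : y ≤ ‖s‖ * a ^ (-s.re - 1) := norm_cpow_neg_sub_le hs ha0 ⟨hx.1.le, hx.2⟩
    have hA : y ≤ 2 * a ^ (-s.re) := by
      refine (norm_sub_le _ _).trans ?_
      rw [Complex.norm_cpow_eq_rpow_re_of_pos hx0, Complex.norm_cpow_eq_rpow_re_of_pos ha0,
        Complex.neg_re]
      have := Real.rpow_le_rpow_of_nonpos ha0 hx.1.le (show -s.re ≤ 0 by linarith)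
      linarith
    have hy0 : 0 ≤ y := norm_nonneg _
    calc y = y ^ θ * y ^ (1 - θ) := by
          rw [← Real.rpow_add_of_nonneg hy0 h0 (by linarith)]; simp
      _ ≤ (‖s‖ * a ^ (-s.re - 1)) ^ θ * (2 * a ^ (-s.re)) ^ (1 - θ) := by
          gcongr
      _ = 2 ^ (1 - θ) * ‖s‖ ^ θ * a ^ (-(s.re + θ)) := by
          rw [Real.mul_rpow (norm_nonneg _) (by positivity),
            Real.mul_rpow zero_le_two (by positivity), ← Real.rpow_mul ha0.le,
            ← Real.rpow_mul ha0.le]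
          rw [show -(s.re + θ) = (-s.re - 1) * θ + -s.re * (1 - θ) by ring, Real.rpow_add ha0]
          ring
      _ ≤ _ := by
          gcongr
          calc (2 : ℝ) ^ (1 - θ) ≤ 2 ^ (1 : ℝ) :=
                Real.rpow_le_rpow_of_exponent_le one_le_two (by linarith)
            _ = 2 := Real.rpow_one 2
  have := intervalIntegral.norm_integral_le_of_norm_le_const hb
  simpa using this

lemma summable_zetaTerm_bound {p : ℝ} (hp : 1 < p) :
    Summable (fun n : ℕ ↦ (n + 1 : ℝ) ^ (-p)) := by
  have := (summable_nat_add_iff 1).mpr (Real.summable_nat_rpow (p := -p) |>.mpr (by linarith))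
  exact_mod_cast this

lemma tsum_zetaTerm_of_one_lt_re {s : ℂ} (hs : 1 < s.re) :
    ∑' n, zetaTerm n s = riemannZeta₀ s := by
  have hs1 : s ≠ 1 := by rintro rfl; simp at hs
  have hsum : Summable fun n ↦ zetaTerm n s := by
    refine Summable.of_norm_bounded
      (g := fun n : ℕ ↦ 2 * ‖s‖ ^ (0 : ℝ) * (n + 1 : ℝ) ^ (-(s.re + 0)))
      ?_ (fun n ↦ norm_zetaTerm_le (by linarith) le_rfl zero_le_one n)
    exact (summable_zetaTerm_bound (by linarith)).mul_left _
  refine tendsto_nhds_unique hsum.hasSum.tendsto_sum_nat ?_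
  have hpart (N : ℕ) : ∑ n ∈ Finset.range N, zetaTerm n s =
      ∑ n ∈ Finset.range N, 1 / ((n : ℂ) + 1) ^ s -
        (((N + 1 : ℝ) : ℂ) ^ (1 - s) - 1) / (1 - s) := by
    induction N with
    | zero => simp
    | succ N ih =>
      rw [Finset.sum_range_succ, Finset.sum_range_succ, ih, zetaTerm_eq hs1]
      push_cast
      rw [Complex.cpow_neg, show (N : ℂ) + 1 + 1 = N + 2 by ring]
      ring
  simp_rw [hpart]
  have hz : Summable fun n : ℕ ↦ 1 / ((n : ℂ) + 1) ^ s := by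
    have := (summable_nat_add_iff 1).mpr (Complex.summable_one_div_nat_cpow.mpr hs)
    exact_mod_cast this
  have h1 := hz.hasSum.tendsto_sum_nat
  rw [← zeta_eq_tsum_one_div_nat_add_one_cpow hs] at h1
  have h2 : Tendsto (fun N : ℕ ↦ ((N + 1 : ℝ) : ℂ) ^ (1 - s)) atTop (𝓝 0) := by
    rw [tendsto_zero_iff_norm_tendsto_zero]
    have h3 : Tendsto (fun N : ℕ ↦ ((N : ℝ) + 1) ^ (-(s.re - 1))) atTop (𝓝 0) :=
      (tendsto_rpow_neg_atTop (by linarith)).comp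
        (tendsto_atTop_add_const_right _ _ tendsto_natCast_atTop_atTop)
    refine h3.congr fun N ↦ ?_
    rw [Complex.norm_cpow_eq_rpow_re_of_pos (by positivity)]
    simp
  have h4 := h1.sub ((h2.sub_const 1).div_const (1 - s))
  convert! h4 using 2
  rw [riemannZeta₀, if_neg hs1]
  have : (1 - s) ≠ 0 := sub_ne_zero.mpr hs1.symm
  have : (s - 1) ≠ 0 := sub_ne_zero.mpr hs1
  field_simp
  ring

/-- The series represents `ζ(s) - 1/(s-1)` to the left of `re s = 1` as well, by the identity
theorem. The restriction to the upper half plane keeps away from `s = 1`, where the closed form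
`zetaTerm_eq` of the terms degenerates. -/
lemma tsum_zetaTerm {s : ℂ} (hs : 39 / 40 < s.re) (him : 0 < s.im) :
    ∑' n, zetaTerm n s = riemannZeta₀ s := by
  set R := ‖s‖ + 5 with hR
  set U : Set ℂ := ({z | 39 / 40 < z.re} ∩ {z | 0 < z.im}) ∩ Metric.ball 0 R with hU
  have hUo : IsOpen U := ((isOpen_lt continuous_const Complex.continuous_re).inter
    (isOpen_lt continuous_const Complex.continuous_im)).inter Metric.isOpen_ball
  have hUc : Convex ℝ U := ((convex_halfSpace_re_gt _).inter (convex_halfSpace_im_gt _)).inter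
    (convex_ball _ _)
  have hd : DifferentiableOn ℂ (fun w ↦ ∑' n, zetaTerm n w) U := by
    refine Complex.differentiableOn_tsum_of_summable_norm
      (u := fun n : ℕ ↦ 2 * R ^ (1 / 20 : ℝ) * (n + 1 : ℝ) ^ (-(39 / 40 + 1 / 20 : ℝ)))
      ((summable_zetaTerm_bound (by norm_num)).mul_left _) (fun n ↦ ?_) hUo (fun n w hw ↦ ?_)
    · have h1 : ∀ w ∈ U, w ≠ 1 := by
        rintro w hw rfl
        simpa using hw.1.2
      refine DifferentiableOn.congr ?_ (fun w hw ↦ zetaTerm_eq (h1 w hw) n)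
      intro w hw
      have h2 : (1 : ℂ) - w ≠ 0 := sub_ne_zero.mpr (h1 w hw).symm
      have h3 : ((n + 1 : ℝ) : ℂ) ≠ 0 := by exact_mod_cast (by positivity : (n + 1 : ℝ) ≠ 0)
      have h4 : ((n + 2 : ℝ) : ℂ) ≠ 0 := by exact_mod_cast (by positivity : (n + 2 : ℝ) ≠ 0)
      refine DifferentiableAt.differentiableWithinAt ?_
      refine DifferentiableAt.sub (DifferentiableAt.const_cpow (by fun_prop) (Or.inl h3)) ?_
      refine DifferentiableAt.div (DifferentiableAt.sub
        (DifferentiableAt.const_cpow (by fun_prop) (Or.inl h4))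
        (DifferentiableAt.const_cpow (by fun_prop) (Or.inl h3))) (by fun_prop) h2
    · -- `39/40 + 1/20 > 1`: the interpolated bound is summable to the left of `re s = 1`
      have hre : 39 / 40 < w.re := hw.1.1
      have hn : ‖w‖ ≤ R := by simpa using (mem_ball_zero_iff.mp hw.2).le
      refine (norm_zetaTerm_le (θ := 1 / 20) (by linarith) (by norm_num) (by norm_num) n).trans ?_
      gcongr
      linarith [(n.cast_nonneg : (0 : ℝ) ≤ n)]
  have hd0 : DifferentiableOn ℂ riemannZeta₀ U := differentiable_riemannZeta₀.differentiableOn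
  have hz : (2 + Complex.I : ℂ) ∈ U := by
    refine ⟨⟨by norm_num, by simp⟩, ?_⟩
    have h1 : ‖(2 + Complex.I : ℂ)‖ ≤ ‖(2 : ℂ)‖ + ‖Complex.I‖ := norm_add_le _ _
    simp only [Complex.norm_ofNat, Complex.norm_I] at h1
    simp only [Metric.mem_ball, dist_zero_right]
    linarith [norm_nonneg s]
  refine (hd.analyticOnNhd hUo).eqOn_of_preconnected_of_eventuallyEq (hd0.analyticOnNhd hUo)
    hUc.isPreconnected hz ?_ ⟨⟨hs, him⟩, by simp [hR]⟩
  have : {z : ℂ | 1 < z.re} ∈ 𝓝 (2 + Complex.I : ℂ) :=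
    (isOpen_lt continuous_const Complex.continuous_re).mem_nhds (by simp)
  filter_upwards [this] with z hz using tsum_zetaTerm_of_one_lt_re hz

lemma riemannZeta₀_conj (s : ℂ) :
    riemannZeta₀ ((starRingEnd ℂ) s) = (starRingEnd ℂ) (riemannZeta₀ s) := by
  by_cases h : s = 1
  · subst h; simp
  · have h' : (starRingEnd ℂ) s ≠ 1 := fun h2 ↦ h (by simpa using congrArg (starRingEnd ℂ) h2)
    simp [riemannZeta₀, h, h', riemannZeta_conj]

/-- The interpolated bound with `θ = 1/20` remains summable for `re s > 39/40`. The exponent is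
chosen small enough for the derivative of `1/((s-1)ζ(s))` to be square integrable on vertical
lines. -/
lemma exists_norm_riemannZeta₀_le :
    ∃ C : ℝ, 0 < C ∧ ∀ s : ℂ, 39 / 40 < s.re → s.im ≠ 0 →
      ‖riemannZeta₀ s‖ ≤ C * ‖s‖ ^ (1 / 20 : ℝ) := by
  set S : ℝ := ∑' n : ℕ, (n + 1 : ℝ) ^ (-(39 / 40 + 1 / 20 : ℝ)) with hS
  have hsum := summable_zetaTerm_bound (p := 39 / 40 + 1 / 20) (by norm_num)
  have hpos : ∀ s : ℂ, 39 / 40 < s.re → 0 < s.im →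
      ‖riemannZeta₀ s‖ ≤ 2 * S * ‖s‖ ^ (1 / 20 : ℝ) := by
    intro s hs him
    rw [← tsum_zetaTerm hs him]
    refine tsum_of_norm_bounded
      (g := fun n : ℕ ↦ 2 * ‖s‖ ^ (1 / 20 : ℝ) * (n + 1 : ℝ) ^ (-(39 / 40 + 1 / 20 : ℝ)))
      ?_ (fun n ↦ ?_)
    · rw [show 2 * S * ‖s‖ ^ (1 / 20 : ℝ) = 2 * ‖s‖ ^ (1 / 20 : ℝ) * S by ring]
      exact hsum.hasSum.mul_left _
    · refine (norm_zetaTerm_le (θ := 1 / 20) (by linarith) (by norm_num) (by norm_num) n).trans ?_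
      gcongr
      linarith [(n.cast_nonneg : (0 : ℝ) ≤ n)]
  refine ⟨2 * S, ?_, fun s hs him ↦ ?_⟩
  · have : 0 < S := hsum.tsum_pos (fun n ↦ by positivity) 0 (by positivity)
    positivity
  · rcases him.lt_or_gt with h | h
    · have := hpos ((starRingEnd ℂ) s) (by simpa using hs) (by simpa using h)
      rwa [riemannZeta₀_conj, Complex.norm_conj, Complex.norm_conj] at this
    · exact hpos s hs h

/-! ### Quantitative non-vanishing of `ζ` on `re s = 1` -/

lemma rpow_twentieth_le {x y k : ℝ} (hx : 0 ≤ x) (hy : 0 ≤ y) (hk : 1 ≤ k) (h : x ≤ k * y) :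
    x ^ (1 / 20 : ℝ) ≤ k * y ^ (1 / 20 : ℝ) := by
  calc x ^ (1 / 20 : ℝ) ≤ (k * y) ^ (1 / 20 : ℝ) := by gcongr
    _ = k ^ (1 / 20 : ℝ) * y ^ (1 / 20 : ℝ) := Real.mul_rpow (by linarith) hy
    _ ≤ k ^ (1 : ℝ) * y ^ (1 / 20 : ℝ) := by
        gcongr
        norm_num
    _ = _ := by rw [Real.rpow_one]

/-- The derivative is controlled by Cauchy's estimate on discs of radius `1/50`. -/
lemma exists_norm_riemannZeta₀_and_deriv_le :
    ∃ C : ℝ, 0 < C ∧ ∀ s : ℂ, 1 ≤ s.re → s.re ≤ 2 → 2 ≤ |s.im| →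
      ‖riemannZeta₀ s‖ ≤ C * |s.im| ^ (1 / 20 : ℝ) ∧
      ‖deriv riemannZeta₀ s‖ ≤ C * |s.im| ^ (1 / 20 : ℝ) := by
  obtain ⟨C, hC, h⟩ := exists_norm_riemannZeta₀_le
  refine ⟨200 * C, by positivity, fun s h1 h2 h3 ↦ ?_⟩
  have hn : ‖s‖ ≤ 2 + |s.im| := by
    refine (Complex.norm_le_abs_re_add_abs_im s).trans ?_
    rw [abs_of_nonneg (by linarith : 0 ≤ s.re)]
    linarith
  have key : ∀ z : ℂ, ‖z - s‖ ≤ 1 / 50 → ‖riemannZeta₀ z‖ ≤ 4 * C * |s.im| ^ (1 / 20 : ℝ) := by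
    intro z hz
    have hre := (abs_le.mp ((Complex.abs_re_le_norm (z - s)).trans hz)).1
    have him := (Complex.abs_im_le_norm (z - s)).trans hz
    simp only [Complex.sub_re, Complex.sub_im] at hre him
    have him0 : z.im ≠ 0 := by
      intro h0
      rw [h0, zero_sub, abs_neg] at him
      linarith
    refine (h z (by linarith) him0).trans ?_
    have : ‖z‖ ≤ 4 * |s.im| := by
      have : ‖z‖ ≤ ‖z - s‖ + ‖s‖ := by simpa using norm_add_le (z - s) s
      linarith
    have := rpow_twentieth_le (norm_nonneg z) (abs_nonneg _) (by norm_num) this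
    calc _ ≤ C * (4 * |s.im| ^ (1 / 20 : ℝ)) := by gcongr
      _ = _ := by ring
  constructor
  · refine (key s (by simp)).trans ?_
    gcongr
    norm_num
  · have := Complex.norm_deriv_le_of_forall_mem_sphere_norm_le (c := s) (R := 1 / 50)
      (f := riemannZeta₀) (C := 4 * C * |s.im| ^ (1 / 20 : ℝ)) (by norm_num)
      differentiable_riemannZeta₀.diffContOnCl
      (fun z hz ↦ key z (by simpa [dist_eq_norm] using (mem_sphere_iff_norm.mp hz).le))
    refine this.trans (le_of_eq ?_)
    ring

lemma exists_norm_riemannZeta_and_deriv_le :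
    ∃ C : ℝ, 0 < C ∧ ∀ s : ℂ, 1 ≤ s.re → s.re ≤ 2 → 2 ≤ |s.im| →
      ‖riemannZeta s‖ ≤ C * |s.im| ^ (1 / 20 : ℝ) ∧
      ‖deriv riemannZeta s‖ ≤ C * |s.im| ^ (1 / 20 : ℝ) := by
  obtain ⟨C, hC, h⟩ := exists_norm_riemannZeta₀_and_deriv_le
  refine ⟨C + 1, by positivity, fun s h1 h2 h3 ↦ ?_⟩
  have hs : s ≠ 1 := by
    rintro rfl
    simp at h3
    linarith
  have hinv : ‖(s - 1)⁻¹‖ ≤ 1 := by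
    rw [norm_inv]
    refine inv_le_one_of_one_le₀ ?_
    have := Complex.abs_im_le_norm (s - 1)
    simp only [Complex.sub_im, Complex.one_im, sub_zero] at this
    linarith
  have hq : 1 ≤ |s.im| ^ (1 / 20 : ℝ) := Real.one_le_rpow (by linarith) (by norm_num)
  obtain ⟨ha, hb⟩ := h s h1 h2 h3
  constructor
  · rw [riemannZeta_eq_inv_sub_add hs]
    refine (norm_add_le _ _).trans ?_
    linarith
  · rw [deriv_riemannZeta_eq_neg_inv_sub_sq_add hs]
    refine (norm_add_le _ _).trans ?_
    rw [norm_neg, norm_pow]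
    have : ‖(s - 1)⁻¹‖ ^ 2 ≤ 1 := pow_le_one₀ (norm_nonneg _) hinv
    linarith

lemma exists_norm_riemannZeta_ofReal_le :
    ∃ C : ℝ, 0 < C ∧ ∀ x : ℝ, 0 < x → x ≤ 1 → ‖riemannZeta (1 + x)‖ ≤ C / x := by
  have hc : Continuous fun x : ℝ ↦ ‖riemannZeta₁ (1 + x)‖ := by
    have := differentiable_riemannZeta₁.continuous
    fun_prop
  obtain ⟨C, hC⟩ := (isCompact_Icc (a := (0 : ℝ)) (b := 1)).bddAbove_image hc.continuousOn
  refine ⟨max C 1, by positivity, fun x hx hx1 ↦ ?_⟩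
  have h1 : (1 + x : ℂ) ≠ 1 := by simpa using hx.ne'
  rw [riemannZeta_eq_inv_sub_mul h1, norm_mul, div_eq_inv_mul]
  have h2 : ‖riemannZeta₁ (1 + x)‖ ≤ C := hC ⟨x, ⟨hx.le, hx1⟩, rfl⟩
  rw [add_sub_cancel_left, norm_inv, Complex.norm_of_nonneg hx.le]
  gcongr
  exact h2.trans (le_max_left _ _)

/-- The consequence of `3 + 4 cos θ + cos 2θ ≥ 0` for the Riemann zeta function. -/
lemma one_le_norm_riemannZeta_product {x : ℝ} (hx : 0 < x) (t : ℝ) :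
    1 ≤ ‖riemannZeta (1 + x)‖ ^ 3 * ‖riemannZeta (1 + x + Complex.I * t)‖ ^ 4 *
      ‖riemannZeta (1 + x + 2 * Complex.I * t)‖ := by
  have h := DirichletCharacter.norm_LSeries_product_ge_one (1 : DirichletCharacter ℂ 1) hx t
  rw [one_pow, DirichletCharacter.LSeries_modOne_eq, LSeries_one_eq_riemannZeta (by simpa),
    LSeries_one_eq_riemannZeta (by simpa), LSeries_one_eq_riemannZeta (by simpa)] at h
  simpa [norm_mul, norm_pow] using h

/-- A quantitative form of the non-vanishing of `ζ` on the line `re s = 1`. -/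
lemma exists_le_norm_riemannZeta :
    ∃ c : ℝ, 0 < c ∧ ∀ s : ℂ, 1 < s.re → s.re ≤ 2 → 2 ≤ |s.im| →
      c ≤ ‖riemannZeta s‖ * |s.im| ^ (1 / 5 : ℝ) := by
  obtain ⟨A, hA, hreal⟩ := exists_norm_riemannZeta_ofReal_le
  obtain ⟨B, hB, hbd⟩ := exists_norm_riemannZeta_and_deriv_le
  obtain ⟨c, hc, hc4⟩ : ∃ c : ℝ, 0 < c ∧ c ^ 4 * (A ^ 3 * (2 * B)) = 1 := by
    refine ⟨((A ^ 3 * (2 * B))⁻¹) ^ (1 / 4 : ℝ), by positivity, ?_⟩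
    rw [← Real.rpow_natCast, ← Real.rpow_mul (by positivity)]
    norm_num
    field_simp
  -- At abscissa `1 + η` with `η = κ⁴ q⁻⁵`, `q = |t|^{1/20}`, the 3-4-1 inequality gives
  -- `|ζ| ≥ c κ³ q⁻⁴`, while `ζ` varies by at most `B q η = B κ⁴ q⁻⁴` further left; `κ` is chosen
  -- to make the latter at most half of the former.
  set κ : ℝ := min 1 (c / (2 * B)) with hκ
  have hκ0 : 0 < κ := by positivity
  have hκ1 : κ ≤ 1 := min_le_left _ _
  have hκ2 : κ * B ≤ c / 2 := by
    calc κ * B ≤ c / (2 * B) * B := by gcongr; exact min_le_right _ _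
      _ = c / 2 := by field_simp
  refine ⟨c * κ ^ 3 / 2, by positivity, fun s h1 h2 h3 ↦ ?_⟩
  set q : ℝ := |s.im| ^ (1 / 20 : ℝ) with hq
  have hq1 : 1 ≤ q := Real.one_le_rpow (by linarith) (by norm_num)
  have hq4 : |s.im| ^ (1 / 5 : ℝ) = q ^ 4 := by
    rw [hq, ← Real.rpow_natCast, ← Real.rpow_mul (abs_nonneg _)]
    norm_num
  rw [hq4]
  -- the lower bound to the right of `1 + κ⁴ q⁻⁵`, from the 3-4-1 inequality
  have hfar : ∀ x : ℝ, κ ^ 4 / q ^ 5 ≤ x → x ≤ 1 →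
      c * κ ^ 3 ≤ ‖riemannZeta (1 + x + Complex.I * s.im)‖ * q ^ 4 := by
    intro x hx hx1
    have hx0 : 0 < x := lt_of_lt_of_le (by positivity) hx
    have h := one_le_norm_riemannZeta_product hx0 s.im
    have e1 := hreal x hx0 hx1
    have e2 := (hbd (1 + x + 2 * Complex.I * s.im) (by simp; linarith) (by simp; linarith)
      (by simp [abs_mul]; linarith)).1
    have e3 : |(1 + x + 2 * Complex.I * s.im : ℂ).im| ^ (1 / 20 : ℝ) ≤ 2 * q := by
      refine rpow_twentieth_le (abs_nonneg _) (abs_nonneg _) one_le_two ?_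
      simp [abs_mul]
    set z := ‖riemannZeta (1 + x + Complex.I * s.im)‖ with hz
    have hz0 : 0 ≤ z := norm_nonneg _
    have e4 : 1 ≤ (A / x) ^ 3 * z ^ 4 * (B * (2 * q)) := by
      refine h.trans ?_
      gcongr
      exact e2.trans (by gcongr)
    have e5 : (c * x ^ (3 : ℕ)) * c ^ 3 ≤ z ^ 4 * q := by
      have : c ^ 4 * x ^ 3 * 1 ≤ c ^ 4 * x ^ 3 * ((A / x) ^ 3 * z ^ 4 * (B * (2 * q))) := by
        gcongr
      have e : c ^ 4 * x ^ 3 * ((A / x) ^ 3 * z ^ 4 * (B * (2 * q))) =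
          (c ^ 4 * (A ^ 3 * (2 * B))) * (z ^ 4 * q) := by
        field_simp
      rw [e, hc4] at this
      linarith
    have e6 : (c * κ ^ 3) ^ 4 ≤ (z * q ^ 4) ^ 4 := by
      have : κ ^ 4 ≤ x * q ^ 5 := (div_le_iff₀ (by positivity)).mp hx
      calc (c * κ ^ 3) ^ 4 = c ^ 4 * (κ ^ 4) ^ 3 := by ring
        _ ≤ c ^ 4 * (x * q ^ 5) ^ 3 := by gcongr
        _ = (c * x ^ 3) * c ^ 3 * q ^ 15 := by ring
        _ ≤ (z ^ 4 * q) * q ^ 15 := by gcongr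
        _ = (z * q ^ 4) ^ 4 := by ring
    exact le_of_pow_le_pow_left₀ (by norm_num) (by positivity) e6
  set η : ℝ := κ ^ 4 / q ^ 5 with hη
  have hη0 : 0 < η := by positivity
  have hη1 : η ≤ 1 := by
    rw [hη, div_le_one (by positivity)]
    exact (pow_le_one₀ hκ0.le hκ1).trans (one_le_pow₀ hq1)
  have hs : s = 1 + ((s.re - 1 : ℝ) : ℂ) + Complex.I * s.im := by
    apply Complex.ext <;> simp
  by_cases hcase : η ≤ s.re - 1
  · have := hfar (s.re - 1) hcase (by linarith)
    rw [← hs] at this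
    have : 0 < c * κ ^ 3 := by positivity
    linarith
  · -- to the left of it, `ζ` changes too little to become small
    push Not at hcase
    have hz := hfar η le_rfl hη1
    set w : ℂ := 1 + η + Complex.I * s.im with hw
    have hseg : ‖riemannZeta s - riemannZeta w‖ ≤ B * q * ‖s - w‖ := by
      refine Convex.norm_image_sub_le_of_norm_deriv_le (𝕜 := ℂ)
        (s := {z : ℂ | (1 < z.re ∧ z.re ≤ 2) ∧ z.im = s.im}) ?_ ?_ ?_ ?_ ?_
      · rintro z ⟨⟨hz1, hz2⟩, hz3⟩
        exact differentiableAt_riemannZeta (by rintro rfl; simp at hz1)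
      · rintro z ⟨⟨hz1, hz2⟩, hz3⟩
        have := (hbd z hz1.le hz2 (by rw [hz3]; exact h3)).2
        rwa [hz3] at this
      · have c1 : Convex ℝ {z : ℂ | 1 < z.re} := convex_halfSpace_re_gt 1
        have c2 : Convex ℝ {z : ℂ | z.re ≤ 2} := convex_halfSpace_re_le 2
        have c3 : Convex ℝ {z : ℂ | z.im = s.im} :=
          convex_hyperplane (f := Complex.im) ⟨Complex.add_im, by simp⟩ s.im
        exact (c1.inter c2).inter c3
      · exact ⟨⟨by simp [hw, hη0], by simp [hw]; linarith⟩, by simp [hw]⟩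
      · exact ⟨⟨h1, h2⟩, rfl⟩
    have hsw : ‖s - w‖ ≤ η := by
      have : s - w = ((s.re - 1 - η : ℝ) : ℂ) := by
        apply Complex.ext <;> simp [hw]
        ring
      rw [this, Complex.norm_real, Real.norm_eq_abs, abs_le]
      constructor <;> linarith
    have hdiff : ‖riemannZeta s - riemannZeta w‖ * q ^ 4 ≤ c * κ ^ 3 / 2 := by
      calc _ ≤ B * q * η * q ^ 4 := by
            gcongr
            exact hseg.trans (by gcongr)
        _ = κ ^ 3 * (κ * B) := by rw [hη]; field_simp
        _ ≤ κ ^ 3 * (c / 2) := by gcongr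
        _ = _ := by ring
    have htri : ‖riemannZeta w‖ ≤ ‖riemannZeta s‖ + ‖riemannZeta s - riemannZeta w‖ := by
      rw [norm_sub_rev]
      simpa using norm_add_le (riemannZeta s) (riemannZeta w - riemannZeta s)
    have : ‖riemannZeta w‖ * q ^ 4 ≤
        (‖riemannZeta s‖ + ‖riemannZeta s - riemannZeta w‖) * q ^ 4 := by gcongr
    linarith

lemma riemannZeta₁_ne_zero {s : ℂ} (hs : 1 ≤ s.re) : riemannZeta₁ s ≠ 0 := by
  by_cases h : s = 1
  · simp [h]
  · intro h0
    have := riemannZeta_eq_inv_sub_mul h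
    rw [h0, mul_zero] at this
    exact riemannZeta_ne_zero_of_one_le_re hs this

/-- The derivative of `1 / ((s-1) ζ(s))` is square integrable along vertical lines, uniformly up
to the line `re s = 1`. -/
lemma exists_norm_deriv_inv_riemannZeta₁_le :
    ∃ C : ℝ, 0 < C ∧ ∀ s : ℂ, 1 < s.re → s.re ≤ 2 →
      ‖deriv (fun z ↦ (riemannZeta₁ z)⁻¹) s‖ ≤ C * (1 + |s.im|) ^ (-(11 / 20) : ℝ) := by
  have hderiv : ∀ s : ℂ, 1 ≤ s.re →
      deriv (fun z ↦ (riemannZeta₁ z)⁻¹) s = -deriv riemannZeta₁ s / riemannZeta₁ s ^ 2 :=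
    fun s hs ↦ deriv_fun_inv'' differentiable_riemannZeta₁.differentiableAt
      (riemannZeta₁_ne_zero hs)
  obtain ⟨B, hB, hbd⟩ := exists_norm_riemannZeta_and_deriv_le
  obtain ⟨c, hc, hlow⟩ := exists_le_norm_riemannZeta
  -- the bounded part of the strip is compact
  obtain ⟨M, hM⟩ : ∃ M : ℝ, ∀ s : ℂ, 1 ≤ s.re → s.re ≤ 2 → |s.im| ≤ 2 →
      ‖deriv (fun z ↦ (riemannZeta₁ z)⁻¹) s‖ ≤ M := by
    have hK : IsCompact (Icc (1 : ℝ) 2 ×ℂ Icc (-2 : ℝ) 2) := isCompact_Icc.reProdIm isCompact_Icc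
    have hcont : ContinuousOn (fun s ↦ ‖-deriv riemannZeta₁ s / riemannZeta₁ s ^ 2‖)
        (Icc (1 : ℝ) 2 ×ℂ Icc (-2 : ℝ) 2) := by
      refine ContinuousOn.norm (ContinuousOn.div ?_ ?_ ?_)
      · exact (differentiable_riemannZeta₁.deriv.continuous.neg).continuousOn
      · exact (differentiable_riemannZeta₁.continuous.pow 2).continuousOn
      · intro s hs
        exact pow_ne_zero 2 (riemannZeta₁_ne_zero (Complex.mem_reProdIm.mp hs).1.1)
    obtain ⟨M, hM⟩ := hK.bddAbove_image hcont
    refine ⟨M, fun s h1 h2 h3 ↦ ?_⟩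
    rw [hderiv s h1]
    exact hM ⟨s, Complex.mem_reProdIm.mpr ⟨⟨h1, h2⟩, abs_le.mp h3⟩, rfl⟩
  set C₁ : ℝ := 4 * B / c ^ 2 with hC₁
  refine ⟨3 * (|M| + 1) + 2 * C₁, by positivity, fun s h1 h2 ↦ ?_⟩
  have hy : 0 < 1 + |s.im| := by positivity
  rcases le_or_gt |s.im| 2 with h3 | h3
  · refine (hM s h1.le h2 h3).trans ?_
    have h4 : (1 / 3 : ℝ) ≤ (1 + |s.im|) ^ (-(11 / 20) : ℝ) := by
      calc (1 / 3 : ℝ) = 3 ^ (-1 : ℝ) := by rw [Real.rpow_neg_one]; norm_num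
        _ ≤ 3 ^ (-(11 / 20) : ℝ) :=
            Real.rpow_le_rpow_of_exponent_le (by norm_num) (by norm_num)
        _ ≤ _ := Real.rpow_le_rpow_of_nonpos hy (by linarith) (by norm_num)
    calc M ≤ (3 * (|M| + 1)) * (1 / 3) := by linarith [le_abs_self M]
      _ ≤ (3 * (|M| + 1) + 2 * C₁) * (1 + |s.im|) ^ (-(11 / 20) : ℝ) := by
          gcongr
          linarith [show 0 < C₁ by positivity]
  · have hs1 : s ≠ 1 := by rintro rfl; simp at h1
    have ht0 : 0 < |s.im| := by linarith
    obtain ⟨b1, b2⟩ := hbd s h1.le h2 h3.le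
    have low := hlow s h1 h2 h3.le
    set t := |s.im| with ht
    set q : ℝ := t ^ (1 / 20 : ℝ) with hq
    have hq1 : 1 ≤ q := Real.one_le_rpow (by linarith) (by norm_num)
    have hq4 : t ^ (1 / 5 : ℝ) = q ^ 4 := by
      rw [hq, ← Real.rpow_natCast, ← Real.rpow_mul ht0.le]
      norm_num
    have hq9 : t ^ (-(11 / 20) : ℝ) = q ^ 9 / t := by
      rw [hq, ← Real.rpow_natCast, ← Real.rpow_mul ht0.le, eq_div_iff ht0.ne',
        ← Real.rpow_add_one ht0.ne']
      norm_num
    rw [hq4] at low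
    have hn1 : t ≤ ‖s - 1‖ := by
      have := Complex.abs_im_le_norm (s - 1)
      simpa [← ht] using this
    have hn2 : ‖s - 1‖ ≤ 2 * t := by
      have := Complex.norm_le_abs_re_add_abs_im (s - 1)
      simp only [Complex.sub_re, Complex.one_re, Complex.sub_im, Complex.one_im, sub_zero] at this
      rw [abs_of_pos (by linarith : 0 < s.re - 1)] at this
      linarith
    have hz1 : riemannZeta₁ s = (s - 1) * riemannZeta s := by
      rw [riemannZeta_eq_inv_sub_mul hs1, mul_inv_cancel_left₀ (sub_ne_zero.mpr hs1)]
    have hz1' : deriv riemannZeta₁ s = riemannZeta s + (s - 1) * deriv riemannZeta s := by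
      have he : riemannZeta₁ =ᶠ[𝓝 s] fun z ↦ (z - 1) * riemannZeta z := by
        filter_upwards [compl_singleton_mem_nhds hs1] with z hz
        rw [riemannZeta_eq_inv_sub_mul hz, mul_inv_cancel_left₀ (sub_ne_zero.mpr hz)]
      rw [he.deriv_eq, deriv_fun_mul (by fun_prop) (differentiableAt_riemannZeta hs1)]
      simp
    have hnum : ‖deriv riemannZeta₁ s‖ ≤ 4 * B * q * t := by
      rw [hz1']
      refine (norm_add_le _ _).trans ?_
      rw [norm_mul]
      calc ‖riemannZeta s‖ + ‖s - 1‖ * ‖deriv riemannZeta s‖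
          ≤ B * q + (2 * t) * (B * q) := by gcongr
        _ ≤ t * (B * q) + (2 * t) * (B * q) := by
            have : B * q ≤ t * (B * q) := le_mul_of_one_le_left (by positivity) (by linarith)
            linarith
        _ ≤ _ := by nlinarith [show 0 < t * (B * q) by positivity]
    have hden : t * c ≤ ‖riemannZeta₁ s‖ * q ^ 4 := by
      rw [hz1, norm_mul, mul_assoc]
      gcongr
    have hden0 : 0 < ‖riemannZeta₁ s‖ := norm_pos_iff.mpr (riemannZeta₁_ne_zero h1.le)
    have hmain : ‖deriv (fun z ↦ (riemannZeta₁ z)⁻¹) s‖ ≤ C₁ * t ^ (-(11 / 20) : ℝ) := by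
      rw [hderiv s h1.le, norm_div, norm_neg, norm_pow, hq9, hC₁, div_mul_div_comm,
        div_le_div_iff₀ (by positivity) (by positivity)]
      calc ‖deriv riemannZeta₁ s‖ * (c ^ 2 * t) ≤ 4 * B * q * t * (c ^ 2 * t) := by gcongr
        _ = 4 * B * q * (t * c) ^ 2 := by ring
        _ ≤ 4 * B * q * (‖riemannZeta₁ s‖ * q ^ 4) ^ 2 := by gcongr
        _ = _ := by ring
    refine hmain.trans ?_
    have h5 : t ^ (-(11 / 20) : ℝ) ≤ 2 * (1 + t) ^ (-(11 / 20) : ℝ) := by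
      calc t ^ (-(11 / 20) : ℝ) ≤ ((1 + t) / 2) ^ (-(11 / 20) : ℝ) :=
            Real.rpow_le_rpow_of_nonpos (by positivity) (by linarith) (by norm_num)
        _ = (1 + t) ^ (-(11 / 20) : ℝ) * (2⁻¹) ^ (-(11 / 20) : ℝ) := by
            rw [div_eq_mul_inv, Real.mul_rpow (by positivity) (by norm_num)]
        _ ≤ (1 + t) ^ (-(11 / 20) : ℝ) * 2 := by
            gcongr
            rw [Real.inv_rpow zero_le_two, Real.rpow_neg zero_le_two, inv_inv]
            calc (2 : ℝ) ^ (11 / 20 : ℝ) ≤ 2 ^ (1 : ℝ) :=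
                  Real.rpow_le_rpow_of_exponent_le one_le_two (by norm_num)
              _ = 2 := Real.rpow_one 2
        _ = _ := by ring
    have hC₁0 : 0 < C₁ := by positivity
    calc C₁ * t ^ (-(11 / 20) : ℝ) ≤ C₁ * (2 * (1 + t) ^ (-(11 / 20) : ℝ)) := by gcongr
      _ = (2 * C₁) * (1 + t) ^ (-(11 / 20) : ℝ) := by ring
      _ ≤ _ := by gcongr; linarith [abs_nonneg M]

/-! ### The summatory function of `μ(n)/n` and its Mellin transform -/

/-- The summatory function `m(x) = ∑_{n ≤ x} μ(n)/n`. -/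
noncomputable def mobiusSum (x : ℝ) : ℝ :=
  ∑ n ∈ Finset.Icc 1 ⌊x⌋₊, ((ArithmeticFunction.moebius n : ℤ) : ℝ) / n

lemma mobiusSum_of_lt_one {x : ℝ} (hx : x < 1) : mobiusSum x = 0 := by
  simp [mobiusSum, Nat.floor_eq_zero.mpr hx]

lemma measurable_mobiusSum : Measurable mobiusSum :=
  (measurable_from_nat (f := fun N : ℕ ↦ ∑ n ∈ Finset.Icc 1 N,
    ((ArithmeticFunction.moebius n : ℤ) : ℝ) / n)).comp Nat.measurable_floor

lemma abs_moebius_div_le (n : ℕ) : |((ArithmeticFunction.moebius n : ℤ) : ℝ) / n| ≤ 1 / n := by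
  rw [abs_div, Nat.abs_cast]
  gcongr
  exact_mod_cast ArithmeticFunction.abs_moebius_le_one

lemma sum_abs_moebius_div_le {x : ℝ} (hx : 1 ≤ x) :
    ∑ n ∈ Finset.Icc 1 ⌊x⌋₊, |((ArithmeticFunction.moebius n : ℤ) : ℝ) / n| ≤ 1 + Real.log x := by
  refine le_trans ?_ (harmonic_floor_le_one_add_log x hx)
  rw [harmonic_eq_sum_Icc]
  push_cast
  refine Finset.sum_le_sum fun n _ ↦ ?_
  simpa using abs_moebius_div_le n

lemma abs_mobiusSum_le {x : ℝ} (hx : 1 ≤ x) : |mobiusSum x| ≤ 1 + Real.log x :=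
  (Finset.abs_sum_le_sum_abs _ _).trans (sum_abs_moebius_div_le hx)

lemma one_add_log_isBigO {r : ℝ} (hr : 0 < r) :
    (fun x ↦ 1 + Real.log x) =O[atTop] fun x : ℝ ↦ x ^ r := by
  refine Asymptotics.IsBigO.add ?_ (isLittleO_log_rpow_atTop hr).isBigO
  refine Asymptotics.IsBigO.of_bound 1 ?_
  filter_upwards [eventually_ge_atTop 1] with x hx
  rw [norm_one, one_mul, Real.norm_eq_abs]
  exact (Real.one_le_rpow hx hr.le).trans (le_abs_self _)

lemma mobiusSum_isBigO {r : ℝ} (hr : 0 < r) :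
    (fun x ↦ (mobiusSum x : ℂ)) =O[atTop] fun x : ℝ ↦ x ^ r := by
  refine Asymptotics.IsBigO.trans ?_ (one_add_log_isBigO hr)
  refine Asymptotics.IsBigO.of_bound 1 ?_
  filter_upwards [eventually_ge_atTop 1] with x hx
  rw [one_mul, Complex.norm_real]
  exact (abs_mobiusSum_le hx).trans (le_abs_self _)

lemma mobiusSum_eventuallyEq_zero :
    (fun x ↦ (mobiusSum x : ℂ)) =ᶠ[𝓝[>] 0] fun _ ↦ 0 := by
  have : Iio (1 : ℝ) ∈ 𝓝[>] (0 : ℝ) := mem_nhdsWithin_of_mem_nhds (Iio_mem_nhds one_pos)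
  filter_upwards [this] with x hx
  rw [mobiusSum_of_lt_one hx, Complex.ofReal_zero]

lemma locallyIntegrableOn_mobiusSum :
    LocallyIntegrableOn (fun x ↦ (mobiusSum x : ℂ)) (Ioi 0) := by
  have h := locallyIntegrableOn_mul_sum_Icc
    (fun n ↦ (((ArithmeticFunction.moebius n : ℤ) : ℝ) / n : ℂ)) (m := 1) (le_refl (0 : ℝ))
    (g := fun _ ↦ (1 : ℂ)) (locallyIntegrableOn_const _)
  refine (h.mono_set Ioi_subset_Ici_self).congr ?_
  refine Eventually.of_forall fun x ↦ ?_
  simp [mobiusSum]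

lemma LSeries_moebius_div {s : ℂ} (hs : 0 < s.re) :
    LSeries (fun n ↦ (((ArithmeticFunction.moebius n : ℤ) : ℝ) / n : ℂ)) s =
      (riemannZeta (1 + s))⁻¹ := by
  have h1 : 1 < (1 + s).re := by simpa using hs
  have h := ArithmeticFunction.LSeries_zeta_mul_Lseries_moebius h1
  rw [ArithmeticFunction.LSeries_zeta_eq_riemannZeta h1] at h
  rw [← eq_inv_of_mul_eq_one_right h]
  refine tsum_congr fun n ↦ ?_
  rcases eq_or_ne n 0 with rfl | hn
  · simp
  · have hn' : (n : ℂ) ≠ 0 := by exact_mod_cast hn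
    rw [LSeries.term_of_ne_zero hn, LSeries.term_of_ne_zero hn, Complex.cpow_add _ _ hn',
      Complex.cpow_one]
    simp only [Complex.ofReal_intCast]
    rw [div_div]

lemma mellin_mobiusSum {s : ℂ} (hs : 0 < s.re) :
    mellin (fun x ↦ (mobiusSum x : ℂ)) (-s) = (riemannZeta₁ (1 + s))⁻¹ := by
  have hs0 : s ≠ 0 := by rintro rfl; simp at hs
  have hO : (fun N : ℕ ↦ ∑ k ∈ Finset.Icc 1 N,
      ‖(((ArithmeticFunction.moebius k : ℤ) : ℝ) / k : ℂ)‖) =O[atTop]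
      fun N : ℕ ↦ (N : ℝ) ^ (s.re / 2) := by
    refine Asymptotics.IsBigO.trans ?_
      ((one_add_log_isBigO (half_pos hs)).comp_tendsto tendsto_natCast_atTop_atTop)
    refine Asymptotics.IsBigO.of_bound 1 ?_
    filter_upwards [eventually_ge_atTop 1] with N hN
    have h := sum_abs_moebius_div_le (x := N) (by exact_mod_cast hN)
    rw [Nat.floor_natCast] at h
    rw [one_mul, Real.norm_of_nonneg (Finset.sum_nonneg fun _ _ ↦ norm_nonneg _)]
    refine le_trans (le_of_eq ?_) (h.trans (le_abs_self _))
    refine Finset.sum_congr rfl fun n _ ↦ ?_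
    rw [← Complex.ofReal_natCast, ← Complex.ofReal_div, Complex.norm_real, Real.norm_eq_abs]
  have h := LSeries_eq_mul_integral' _ (half_pos hs).le (half_lt_self hs) hO
  rw [LSeries_moebius_div hs] at h
  have hmel : mellin (fun x ↦ (mobiusSum x : ℂ)) (-s) = ∫ t in Ioi (1 : ℝ),
      (∑ k ∈ Finset.Icc 1 ⌊t⌋₊, (((ArithmeticFunction.moebius k : ℤ) : ℝ) / k : ℂ)) *
        (t : ℂ) ^ (-(s + 1)) := by
    rw [mellin, ← integral_indicator measurableSet_Ioi, ← integral_Ici_eq_integral_Ioi,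
      ← integral_indicator measurableSet_Ici]
    refine integral_congr_ae (Eventually.of_forall fun t ↦ ?_)
    simp only [indicator, mem_Ioi, mem_Ici]
    by_cases h1 : 1 ≤ t
    · rw [if_pos h1, if_pos (by linarith), smul_eq_mul, mul_comm, show -s - 1 = -(s + 1) by ring]
      simp [mobiusSum]
    · rw [if_neg h1, mobiusSum_of_lt_one (by linarith)]
      simp
  rw [hmel]
  have h1 : (1 + s : ℂ) ≠ 1 := by simpa using hs0
  rw [riemannZeta_eq_inv_sub_mul h1, add_sub_cancel_left, mul_inv, inv_inv] at h
  exact (mul_left_cancel₀ hs0 h).symm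

lemma hasDerivAt_mellin_mobiusSum {s : ℂ} (hs : 0 < s.re) :
    MellinConvergent (fun t ↦ Real.log t • (mobiusSum t : ℂ)) (-s) ∧
      mellin (fun t ↦ Real.log t • (mobiusSum t : ℂ)) (-s) =
        -deriv (fun z ↦ (riemannZeta₁ z)⁻¹) (1 + s) := by
  obtain ⟨h1, h2⟩ := mellin_hasDerivAt_of_isBigO_rpow (f := fun x ↦ (mobiusSum x : ℂ)) (s := -s)
    (a := -(s.re / 2)) (b := -s.re - 1) locallyIntegrableOn_mobiusSum
    (by simpa using mobiusSum_isBigO (half_pos hs)) (by simp; linarith)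
    (mobiusSum_eventuallyEq_zero.trans_isBigO (Asymptotics.isBigO_zero _ _)) (by simp)
  refine ⟨h1, ?_⟩
  have hev : mellin (fun x ↦ (mobiusSum x : ℂ)) =ᶠ[𝓝 (-s)]
      fun z ↦ (riemannZeta₁ (1 - z))⁻¹ := by
    have : {z : ℂ | z.re < 0} ∈ 𝓝 (-s) :=
      (isOpen_lt Complex.continuous_re continuous_const).mem_nhds (by simpa using hs)
    filter_upwards [this] with z hz
    have := mellin_mobiusSum (s := -z) (by simpa using hz)
    rwa [neg_neg, ← sub_eq_add_neg] at this
  have h3 := h2.congr_of_eventuallyEq hev.symm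
  rw [← h3.deriv]
  have := deriv_comp_const_sub (f := fun z ↦ (riemannZeta₁ z)⁻¹) 1 (-s)
  rwa [sub_neg_eq_add] at this

/-! ### Integrability of `m(x)/x` -/

/-- The damped function `u ↦ e^{σu} (-u) m(e^{-u})`. Its Fourier transform consists of the values
on `re s = -σ` of the Mellin transform of `m(x) log x`. -/
noncomputable def dampedMobius (σ u : ℝ) : ℂ :=
  Real.exp (σ * u) • (-u) • (mobiusSum (Real.exp (-u)) : ℂ)

lemma dampedMobius_of_pos (σ : ℝ) {u : ℝ} (hu : 0 < u) : dampedMobius σ u = 0 := by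
  rw [dampedMobius, mobiusSum_of_lt_one (by simpa using hu)]
  simp

lemma measurable_dampedMobius (σ : ℝ) : Measurable (dampedMobius σ) := by
  have := measurable_mobiusSum
  unfold dampedMobius
  fun_prop

lemma norm_dampedMobius_le (σ : ℝ) {u : ℝ} (hu : u ≤ 0) :
    ‖dampedMobius σ u‖ ≤ Real.exp (σ * u) * ((-u) * (1 - u)) := by
  have h1 : |mobiusSum (Real.exp (-u))| ≤ 1 - u := by
    have := abs_mobiusSum_le (x := Real.exp (-u)) (by simpa using hu)
    rwa [Real.log_exp, ← sub_eq_add_neg] at this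
  rw [dampedMobius, norm_smul, norm_smul, Complex.norm_real, Real.norm_eq_abs, Real.norm_eq_abs,
    Real.norm_eq_abs, abs_of_pos (Real.exp_pos _), abs_of_nonneg (by linarith : 0 ≤ -u)]
  gcongr
  linarith

/-- A polynomial factor is absorbed by half of the exponential decay. -/
lemma norm_dampedMobius_le_indicator {σ : ℝ} (hσ : 0 < σ) (u : ℝ) :
    ‖dampedMobius σ u‖ ≤
      (Iic (0 : ℝ)).indicator (fun u ↦ (4 / σ * (1 + 4 / σ)) * Real.exp (σ / 2 * u)) u := by
  by_cases hu : u ≤ 0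
  · rw [indicator_of_mem (mem_Iic.mpr hu)]
    refine (norm_dampedMobius_le σ hu).trans ?_
    have hE : σ / 4 * (-u) + 1 ≤ Real.exp (σ / 4 * (-u)) := Real.add_one_le_exp _
    have h1 : -u ≤ 4 / σ * Real.exp (σ / 4 * (-u)) := by
      calc -u = 4 / σ * (σ / 4 * (-u)) := by field_simp
        _ ≤ _ := by gcongr; linarith
    have h0 : 1 ≤ Real.exp (σ / 4 * (-u)) := by
      rw [Real.one_le_exp_iff]
      have : 0 ≤ -u := by linarith
      positivity
    have h2 : 1 - u ≤ (1 + 4 / σ) * Real.exp (σ / 4 * (-u)) := by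
      rw [add_mul, one_mul, sub_eq_add_neg]
      exact add_le_add h0 h1
    calc Real.exp (σ * u) * ((-u) * (1 - u))
        ≤ Real.exp (σ * u) * ((4 / σ * Real.exp (σ / 4 * (-u))) *
          ((1 + 4 / σ) * Real.exp (σ / 4 * (-u)))) := by
          gcongr
          linarith
      _ = (4 / σ * (1 + 4 / σ)) *
          Real.exp (σ * u + σ / 4 * (-u) + σ / 4 * (-u)) := by
          rw [Real.exp_add, Real.exp_add]; ring
      _ = _ := by ring_nf
  · rw [dampedMobius_of_pos σ (not_le.mp hu), norm_zero, indicator_of_notMem (by simpa using hu)]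

lemma integrable_dampedMobius {σ : ℝ} (hσ : 0 < σ) : Integrable (dampedMobius σ) := by
  refine Integrable.mono' ?_ (measurable_dampedMobius σ).aestronglyMeasurable
    (Eventually.of_forall (norm_dampedMobius_le_indicator hσ))
  rw [integrable_indicator_iff measurableSet_Iic]
  exact (integrableOn_exp_mul_Iic (by positivity) 0).const_mul _

lemma memLp_dampedMobius {σ : ℝ} (hσ : 0 < σ) : MemLp (dampedMobius σ) 2 := by
  rw [memLp_two_iff_integrable_sq_norm (measurable_dampedMobius σ).aestronglyMeasurable]
  refine Integrable.mono' ((integrable_dampedMobius hσ).norm.const_mul (4 / σ * (1 + 4 / σ)))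
    ((measurable_dampedMobius σ).norm.pow_const 2).aestronglyMeasurable
    (Eventually.of_forall fun u ↦ ?_)
  rw [Real.norm_of_nonneg (by positivity), pow_two]
  gcongr
  refine (norm_dampedMobius_le_indicator hσ u).trans ?_
  refine indicator_le' (f := fun u ↦ (4 / σ * (1 + 4 / σ)) * Real.exp (σ / 2 * u))
    (g := fun _ ↦ 4 / σ * (1 + 4 / σ)) (fun v hv ↦ ?_) (fun v _ ↦ by positivity) u
  refine mul_le_of_le_one_right (by positivity) ?_
  rw [Real.exp_le_one_iff]
  exact mul_nonpos_of_nonneg_of_nonpos (by positivity) hv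

lemma fourier_dampedMobius {σ : ℝ} (hσ : 0 < σ) (ξ : ℝ) :
    𝓕 (dampedMobius σ) ξ =
      -deriv (fun z ↦ (riemannZeta₁ z)⁻¹) (1 + (σ - 2 * Real.pi * ξ * Complex.I)) := by
  rw [← (hasDerivAt_mellin_mobiusSum (s := σ - 2 * Real.pi * ξ * Complex.I) (by simpa)).2,
    mellin_eq_fourier]
  refine congrArg₂ (fun (f : ℝ → ℂ) x ↦ 𝓕 f x) ?_ ?_
  · ext u
    simp [dampedMobius]
  · simp

lemma exists_eLpNorm_dampedMobius_le :
    ∃ K : ℝ≥0∞, K ≠ ∞ ∧ ∀ σ : ℝ, 0 < σ → σ ≤ 1 → eLpNorm (dampedMobius σ) 2 volume ≤ K := by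
  obtain ⟨C, hC, h⟩ := exists_norm_deriv_inv_riemannZeta₁_le
  set g : ℝ → ℝ := fun ξ ↦ C * (1 + |ξ|) ^ (-(11 / 20) : ℝ) with hg
  have hgc : Continuous g := by
    refine continuous_const.mul (Continuous.rpow_const (by fun_prop) fun x ↦ Or.inl ?_)
    positivity
  have hg2 : MemLp g 2 := by
    rw [memLp_two_iff_integrable_sq hgc.aestronglyMeasurable]
    have := (integrable_one_add_norm (E := ℝ) (μ := volume) (r := 11 / 10)
      (by norm_num)).const_mul (C ^ 2)
    refine this.congr (Eventually.of_forall fun x ↦ ?_)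
    simp only [hg, Real.norm_eq_abs]
    rw [mul_pow, ← Real.rpow_natCast ((1 + |x|) ^ (-(11 / 20) : ℝ)),
      ← Real.rpow_mul (by positivity)]
    norm_num
  refine ⟨eLpNorm g 2 volume, hg2.eLpNorm_ne_top, fun σ h0 h1 ↦ ?_⟩
  have hle : ∀ ξ, ‖𝓕 (dampedMobius σ) ξ‖ ≤ g ξ := by
    intro ξ
    rw [fourier_dampedMobius h0, norm_neg]
    refine (h _ (by simpa) (by simp; linarith)).trans ?_
    simp only [hg]
    gcongr 1
    · refine Real.rpow_le_rpow_of_nonpos (by positivity) ?_ (by norm_num)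
      simp only [Complex.add_im, Complex.one_im, zero_add, Complex.sub_im, Complex.ofReal_im]
      simp [abs_mul, abs_of_pos Real.pi_pos]
      have : 1 ≤ 2 * Real.pi := by linarith [Real.pi_gt_three]
      exact le_mul_of_one_le_left (abs_nonneg _) this
  have hm : Continuous (𝓕 (dampedMobius σ)) :=
    VectorFourier.fourierIntegral_continuous Real.continuous_fourierChar
      (by exact continuous_inner) (integrable_dampedMobius h0)
  have hF : MemLp (𝓕 (dampedMobius σ)) 2 :=
    hg2.mono' hm.aestronglyMeasurable (Eventually.of_forall hle)
  rw [← eLpNorm_fourier_eq (integrable_dampedMobius h0) (memLp_dampedMobius h0) hF]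
  exact eLpNorm_mono_real hle

/-- The uniform `L²` bound passes to the limit `σ → 0⁺` by Fatou's lemma. -/
lemma memLp_dampedMobius_zero : MemLp (dampedMobius 0) 2 := by
  obtain ⟨K, hK, h⟩ := exists_eLpNorm_dampedMobius_le
  refine ⟨(measurable_dampedMobius 0).aestronglyMeasurable, lt_of_le_of_lt ?_ hK.lt_top⟩
  have hlim : ∀ u, Tendsto (fun n : ℕ ↦ dampedMobius (1 / ((n : ℝ) + 1)) u) atTop
      (𝓝 (dampedMobius 0 u)) := by
    intro u
    have hc : Continuous fun σ ↦ dampedMobius σ u := by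
      unfold dampedMobius
      fun_prop
    exact (hc.tendsto 0).comp tendsto_one_div_add_atTop_nhds_zero_nat
  refine (Lp.eLpNorm_lim_le_liminf_eLpNorm
    (fun n ↦ (measurable_dampedMobius _).aestronglyMeasurable) _
    (Eventually.of_forall hlim)).trans ?_
  refine liminf_le_of_le (by isBoundedDefault) fun b hb ↦ ?_
  obtain ⟨n, hn⟩ := hb.exists
  refine hn.trans (h _ (by positivity) ?_)
  rw [div_le_one (by positivity)]
  linarith [(n.cast_nonneg : (0 : ℝ) ≤ n)]

/-- The prime number theorem in the mean: `∫ |m(x)|/x dx < ∞`. -/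
theorem integrableOn_mobiusSum_div : IntegrableOn (fun x ↦ mobiusSum x / x) (Ioi 0) := by
  have h1 := (memLp_two_iff_integrable_sq_norm memLp_dampedMobius_zero.1).mp
    memLp_dampedMobius_zero
  have h2 : Integrable fun u : ℝ ↦ mobiusSum (Real.exp (-u)) := by
    refine (h1.add (integrable_inv_one_add_sq.const_mul 4)).mono'
      (measurable_mobiusSum.comp (by fun_prop)).aestronglyMeasurable
      (Eventually.of_forall fun u ↦ ?_)
    have hn : ‖dampedMobius 0 u‖ = |u| * |mobiusSum (Real.exp (-u))| := by
      simp [dampedMobius]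
    rw [Pi.add_apply, Real.norm_eq_abs, hn]
    set y := |mobiusSum (Real.exp (-u))| with hy
    have hy0 : 0 ≤ y := abs_nonneg _
    rcases lt_or_ge 0 u with h | h
    · have : y = 0 := by rw [hy, mobiusSum_of_lt_one (by simpa using h), abs_zero]
      rw [this]
      positivity
    · rcases le_or_gt (-1) u with h' | h'
      · have : y ≤ 1 - u := by
          have := abs_mobiusSum_le (x := Real.exp (-u)) (by simpa using h)
          rwa [Real.log_exp, ← sub_eq_add_neg] at this
        have h4 : (2 : ℝ) ≤ 4 * (1 + u ^ 2)⁻¹ := by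
          rw [← div_eq_mul_inv, le_div_iff₀ (by positivity)]
          nlinarith
        have : 0 ≤ (|u| * y) ^ 2 := by positivity
        linarith
      · -- `y ≤ u² y² + u⁻²`
        have h4 : (u ^ 2)⁻¹ ≤ 4 * (1 + u ^ 2)⁻¹ := by
          rw [← div_eq_mul_inv, ← one_div, div_le_div_iff₀ (by nlinarith) (by positivity)]
          nlinarith
        have h5 : 0 < u ^ 2 := by nlinarith
        have h7 : u ≠ 0 := by linarith
        have h6 : y ≤ (|u| * y) ^ 2 + (u ^ 2)⁻¹ := by
          rw [mul_pow, sq_abs, ← sub_nonneg]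
          have : u ^ 2 * y ^ 2 + (u ^ 2)⁻¹ - y =
              (u ^ 2)⁻¹ * ((u ^ 2 * y - 1 / 2) ^ 2 + 3 / 4) := by field_simp; ring
          rw [this]
          positivity
        linarith
  have h3 : Integrable fun u : ℝ ↦ mobiusSum (Real.exp u) := by
    simpa using h2.comp_neg
  rw [← Real.range_exp, ← image_univ, integrableOn_image_iff_integrableOn_abs_deriv_smul
    MeasurableSet.univ (fun x _ ↦ (Real.hasDerivAt_exp x).hasDerivWithinAt)
    Real.exp_injective.injOn, integrableOn_univ]
  refine h3.congr (Eventually.of_forall fun u ↦ ?_)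
  simp only [abs_of_pos (Real.exp_pos u), smul_eq_mul]
  field_simp

/-! ### Convergence of `∑ μ(n)/n` and summation by parts -/

lemma abs_mobiusSum_sub_le {x y : ℝ} (hx : 1 ≤ x) (hxy : x ≤ y) :
    |mobiusSum y - mobiusSum x| ≤ (y - x + 1) / x := by
  have hfl : ⌊x⌋₊ ≤ ⌊y⌋₊ := Nat.floor_mono hxy
  have hsplit : mobiusSum y - mobiusSum x =
      ∑ n ∈ Finset.Ioc ⌊x⌋₊ ⌊y⌋₊, ((ArithmeticFunction.moebius n : ℤ) : ℝ) / n := by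
    rw [mobiusSum, mobiusSum, sub_eq_iff_eq_add']
    have h := Finset.sum_Ioc_consecutive
      (fun n : ℕ ↦ ((ArithmeticFunction.moebius n : ℤ) : ℝ) / n) (Nat.zero_le ⌊x⌋₊) hfl
    simpa only [← Finset.Icc_add_one_left_eq_Ioc, zero_add] using h.symm
  rw [hsplit]
  calc _ ≤ ∑ n ∈ Finset.Ioc ⌊x⌋₊ ⌊y⌋₊, 1 / x := by
        refine (Finset.abs_sum_le_sum_abs _ _).trans (Finset.sum_le_sum fun n hn ↦ ?_)
        refine (abs_moebius_div_le n).trans ?_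
        have : x < n := Nat.lt_of_floor_lt (Finset.mem_Ioc.mp hn).1
        gcongr
    _ = ((⌊y⌋₊ : ℝ) - ⌊x⌋₊) / x := by
        rw [Finset.sum_const, Nat.card_Ioc, nsmul_eq_mul, Nat.cast_sub hfl]
        ring
    _ ≤ _ := by
        gcongr
        have h1 := Nat.floor_le (a := y) (by linarith)
        have h2 := Nat.lt_floor_add_one x
        linarith

lemma integrableOn_abs_mobiusSum_div : IntegrableOn (fun x ↦ |mobiusSum x| / x) (Ioi 0) := by
  refine IntegrableOn.congr_fun (f := fun x ↦ ‖mobiusSum x / x‖) integrableOn_mobiusSum_div.norm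
    (fun x hx ↦ ?_) measurableSet_Ioi
  simp [abs_of_pos (mem_Ioi.mp hx)]

lemma intervalIntegrable_mobiusSum_div {x y : ℝ} (hx : 0 ≤ x) (hy : 0 ≤ y) :
    IntervalIntegrable (fun x ↦ |mobiusSum x| / x) volume x y := by
  rw [intervalIntegrable_iff]
  exact integrableOn_abs_mobiusSum_div.mono_set fun z hz ↦ (le_min hx hy).trans_lt hz.1

/-- `∑ μ(n)/n = 0`. Since `m` oscillates slowly, `|m(x)|` is at most its mean over
`[x, (1 + η) x]` up to an error `η + 1/x`, and these means tend to zero. -/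
theorem tendsto_mobiusSum : Tendsto mobiusSum atTop (𝓝 0) := by
  have hI := intervalIntegral_tendsto_integral_Ioi 0 integrableOn_abs_mobiusSum_div tendsto_id
  rw [tendsto_zero_iff_abs_tendsto_zero, Metric.tendsto_atTop']
  intro ε hε
  set η := ε / 3 with hη
  have hη0 : 0 < η := by positivity
  have hJ : Tendsto (fun x : ℝ ↦ (1 + η) / η * ∫ y in x..(1 + η) * x, |mobiusSum y| / y)
      atTop (𝓝 0) := by
    have h1 : Tendsto (fun x : ℝ ↦ (1 + η) * x) atTop atTop :=
      tendsto_id.const_mul_atTop (by positivity)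
    have h2 := ((hI.comp h1).sub hI).const_mul ((1 + η) / η)
    rw [sub_self, mul_zero] at h2
    refine h2.congr' ?_
    filter_upwards [eventually_ge_atTop 0] with x hx
    simp only [Function.comp_apply, id_eq]
    rw [intervalIntegral.integral_interval_sub_left]
    · exact intervalIntegrable_mobiusSum_div le_rfl (by positivity)
    · exact intervalIntegrable_mobiusSum_div le_rfl hx
  have he : ∀ᶠ x : ℝ in atTop, |mobiusSum x| < ε := by
    filter_upwards [hJ.eventually_lt_const hη0, eventually_ge_atTop 1,
      eventually_gt_atTop (1 / η)] with x hJx hx1 hx2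
    have hx0 : 0 < x := by linarith
    have hxy : x ≤ (1 + η) * x := by nlinarith
    have hmono : ∫ y in x..(1 + η) * x, |mobiusSum x| ≤
        ∫ y in x..(1 + η) * x, ((1 + η) * x * (|mobiusSum y| / y) + (η + 1 / x)) := by
      refine intervalIntegral.integral_mono_on hxy intervalIntegrable_const
        (((intervalIntegrable_mobiusSum_div hx0.le (by positivity)).const_mul _).add
          intervalIntegrable_const) fun y hy ↦ ?_
      have h1 := abs_mobiusSum_sub_le hx1 hy.1
      have hy0 : 0 < y := hx0.trans_le hy.1
      have h2 : (y - x + 1) / x ≤ η + 1 / x := by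
        rw [div_le_iff₀ hx0, add_mul, one_div_mul_cancel hx0.ne']
        linarith [hy.2]
      have h3 : |mobiusSum y| ≤ (1 + η) * x * (|mobiusSum y| / y) := by
        rw [mul_div_assoc', le_div_iff₀ hy0, mul_comm]
        gcongr
        exact hy.2
      have h4 := abs_sub_abs_le_abs_sub (mobiusSum x) (mobiusSum y)
      rw [abs_sub_comm] at h4
      linarith
    rw [intervalIntegral.integral_add
      ((intervalIntegrable_mobiusSum_div hx0.le (by positivity)).const_mul _)
      intervalIntegrable_const, intervalIntegral.integral_const_mul,
      intervalIntegral.integral_const, intervalIntegral.integral_const, smul_eq_mul,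
      smul_eq_mul] at hmono
    set J := ∫ y in x..(1 + η) * x, |mobiusSum y| / y with hJdef
    have h5 : η * x * |mobiusSum x| ≤ η * x * ((1 + η) / η * J + (η + 1 / x)) := by
      calc η * x * |mobiusSum x| = ((1 + η) * x - x) * |mobiusSum x| := by ring
        _ ≤ _ := hmono
        _ = _ := by field_simp; ring
    have h6 := le_of_mul_le_mul_left h5 (by positivity)
    have h7 : 1 / x < η := by
      rw [div_lt_iff₀ hx0]
      rwa [div_lt_iff₀ hη0, mul_comm] at hx2
    linarith
  obtain ⟨N, hN⟩ := eventually_atTop.mp he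
  exact ⟨N, fun x hx ↦ by simpa [Real.dist_eq] using hN x hx.le⟩

/-- Summation by parts for the conditionally convergent series `∑ μ(n)/n g(n)`. -/
theorem tendsto_sum_moebius_mul {g : ℝ → ℝ} (hdiff : ∀ x ∈ Ici (1 : ℝ), DifferentiableAt ℝ g x)
    (hcont : ContinuousOn (deriv g) (Ici 1)) {B C : ℝ} (hB : ∀ x, 1 ≤ x → |g x| ≤ B)
    (hC : ∀ x, 1 ≤ x → |deriv g x| ≤ C / x) :
    Tendsto (fun N : ℕ ↦ ∑ n ∈ Finset.Icc 1 N,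
        ((ArithmeticFunction.moebius n : ℤ) : ℝ) / n * g n) atTop
      (𝓝 (-∫ x in Ioi (1 : ℝ), deriv g x * mobiusSum x)) := by
  set c : ℕ → ℝ := fun n ↦ ((ArithmeticFunction.moebius n : ℤ) : ℝ) / n with hc
  have hc0 : c 0 = 0 := by simp [hc]
  have hIcc (f : ℕ → ℝ) (hf : f 0 = 0) (N : ℕ) :
      ∑ k ∈ Finset.Icc 0 N, f k = ∑ k ∈ Finset.Icc 1 N, f k := by
    rw [Finset.Icc_eq_cons_Ioc (Nat.zero_le _), Finset.sum_cons, hf, zero_add,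
      ← Finset.Icc_add_one_left_eq_Ioc, zero_add]
  have hm (x : ℝ) : ∑ k ∈ Finset.Icc 0 ⌊x⌋₊, c k = mobiusSum x := hIcc c hc0 _
  have hlim : Tendsto (fun N : ℕ ↦ g N * ∑ k ∈ Finset.Icc 0 N, c k) atTop (𝓝 0) := by
    refine bdd_le_mul_tendsto_zero' B ?_ ?_
    · filter_upwards [eventually_ge_atTop 1] with N hN
      exact hB N (by exact_mod_cast hN)
    · refine (tendsto_mobiusSum.comp tendsto_natCast_atTop_atTop).congr fun N ↦ ?_
      rw [Function.comp_apply, ← hm, Nat.floor_natCast]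
  have hdom : (fun x ↦ deriv g x * ∑ k ∈ Finset.Icc 0 ⌊x⌋₊, c k) =O[atTop]
      fun x ↦ mobiusSum x / x := by
    refine Asymptotics.IsBigO.of_bound C ?_
    filter_upwards [eventually_ge_atTop 1] with x hx
    rw [hm, norm_mul, norm_div, Real.norm_eq_abs, Real.norm_eq_abs, Real.norm_eq_abs,
      abs_of_pos (by linarith : 0 < x)]
    calc _ ≤ C / x * |mobiusSum x| := by gcongr; exact hC x hx
      _ = _ := by ring
  have h := tendsto_sum_mul_atTop_nhds_one_sub_integral₀ c hc0 hdiff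
    (hcont.locallyIntegrableOn measurableSet_Ici) hlim hdom
    ⟨Ioi 0, Ioi_mem_atTop 0, integrableOn_mobiusSum_div⟩
  simp_rw [hm, zero_sub] at h
  refine h.congr fun N ↦ ?_
  rw [hIcc (fun k ↦ g k * c k) (by simp [hc0])]
  exact Finset.sum_congr rfl fun n _ ↦ mul_comm _ _

/-! ### The fractional part against an exponential density -/

/-- The mean value `L(b) = b⁻¹ ∫₀^∞ {t} e^{-t/b} dt` of the fractional part against an exponential
density. -/
noncomputable def fractMean (b : ℝ) : ℝ :=
  (∫ t in Ioi (0 : ℝ), Int.fract t * Real.exp (-t / b)) / b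

lemma integrableOn_exp_neg_div {b : ℝ} (hb : 0 < b) :
    IntegrableOn (fun t : ℝ ↦ Real.exp (-t / b)) (Ioi 0) := by
  refine (integrableOn_exp_mul_Ioi (a := -(1 / b)) (by simpa using hb) 0).congr_fun
    (fun t _ ↦ ?_) measurableSet_Ioi
  simp only
  congr 1
  ring

lemma integral_exp_neg_div {b : ℝ} (hb : 0 < b) :
    ∫ t in Ioi (0 : ℝ), Real.exp (-t / b) = b := by
  have h := integral_exp_mul_Ioi (a := -(1 / b)) (by simpa using hb) 0
  have h2 : (fun t : ℝ ↦ Real.exp (-t / b)) = fun t ↦ Real.exp (-(1 / b) * t) := by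
    ext t
    congr 1
    ring
  rw [h2, h]
  simp

lemma integrableOn_fract_mul_exp {b : ℝ} (hb : 0 < b) :
    IntegrableOn (fun t : ℝ ↦ Int.fract t * Real.exp (-t / b)) (Ioi 0) := by
  refine Integrable.mono' (integrableOn_exp_neg_div hb)
    (measurable_fract.mul (by fun_prop)).aestronglyMeasurable (Eventually.of_forall fun t ↦ ?_)
  rw [norm_mul, Real.norm_of_nonneg (Int.fract_nonneg t), Real.norm_of_nonneg (Real.exp_pos _).le]
  exact mul_le_of_le_one_left (Real.exp_pos _).le (Int.fract_lt_one t).le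

lemma fractMean_nonneg {b : ℝ} (hb : 0 < b) : 0 ≤ fractMean b :=
  div_nonneg (setIntegral_nonneg measurableSet_Ioi fun t _ ↦
    mul_nonneg (Int.fract_nonneg t) (Real.exp_pos _).le) hb.le

lemma fractMean_le_one {b : ℝ} (hb : 0 < b) : fractMean b ≤ 1 := by
  rw [fractMean, div_le_one hb]
  calc _ ≤ ∫ t in Ioi (0 : ℝ), Real.exp (-t / b) :=
        setIntegral_mono_on (integrableOn_fract_mul_exp hb) (integrableOn_exp_neg_div hb)
          measurableSet_Ioi fun t _ ↦
            mul_le_of_le_one_left (Real.exp_pos _).le (Int.fract_lt_one t).le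
    _ = b := integral_exp_neg_div hb

/-- The integral over a period repeats with ratio `e^{-1/b}`, which determines the whole
integral. -/
lemma fractMean_eq {b : ℝ} (hb : 0 < b) :
    fractMean b = b - Real.exp (-1 / b) / (1 - Real.exp (-1 / b)) := by
  set E := Real.exp (-1 / b) with hE
  have hE1 : E < 1 := by
    rw [hE, Real.exp_lt_one_iff]
    exact div_neg_of_neg_of_pos (by norm_num) hb
  have hint := integrableOn_fract_mul_exp hb
  set J := ∫ t in Ioi (0 : ℝ), Int.fract t * Real.exp (-t / b) with hJ
  have hshift : ∫ t in Ioi (1 : ℝ), Int.fract t * Real.exp (-t / b) = E * J := by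
    have h := (measurePreserving_add_right volume (1 : ℝ)).setIntegral_preimage_emb
      (measurableEmbedding_addRight 1) (fun t : ℝ ↦ Int.fract t * Real.exp (-t / b)) (Ioi 1)
    rw [preimage_add_const_Ioi, sub_self] at h
    rw [← h, hJ, ← integral_const_mul]
    refine integral_congr_ae (Eventually.of_forall fun t ↦ ?_)
    simp only [Int.fract_add_one]
    rw [show -(t + 1) / b = -1 / b + -t / b by ring, Real.exp_add, ← hE]
    ring
  have hfirst : ∫ t in (0 : ℝ)..1, Int.fract t * Real.exp (-t / b) = b ^ 2 - E * (b ^ 2 + b) := by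
    have h1 : ∫ t in (0 : ℝ)..1, Int.fract t * Real.exp (-t / b) =
        ∫ t in (0 : ℝ)..1, t * Real.exp (-t / b) := by
      refine intervalIntegral.integral_congr_ae ?_
      have : ∀ᵐ t : ℝ, t ≠ 1 := by simp [ae_iff]
      filter_upwards [this] with t ht hmem
      rw [uIoc_of_le zero_le_one] at hmem
      rw [Int.fract_eq_self.mpr ⟨hmem.1.le, lt_of_le_of_ne hmem.2 ht⟩]
    rw [h1, intervalIntegral.integral_eq_sub_of_hasDerivAt
      (f := fun t ↦ -(b * t + b ^ 2) * Real.exp (-t / b))]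
    · rw [hE]
      simp
      ring
    · intro t _
      have h2 : HasDerivAt (fun t : ℝ ↦ Real.exp (-t / b)) (Real.exp (-t / b) * (-1 / b)) t :=
        ((hasDerivAt_neg t).div_const b).exp
      have h3 : HasDerivAt (fun t : ℝ ↦ -(b * t + b ^ 2)) (-(b * 1)) t :=
        (((hasDerivAt_id t).const_mul b).add_const (b ^ 2)).neg
      refine (h3.mul h2).congr_deriv ?_
      field_simp
      ring
    · exact Continuous.intervalIntegrable (by fun_prop) _ _
  have hsplit : J = (b ^ 2 - E * (b ^ 2 + b)) + E * J := by
    rw [← hfirst, ← hshift, intervalIntegral.integral_of_le zero_le_one, hJ,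
      ← setIntegral_union (Ioc_disjoint_Ioi le_rfl) measurableSet_Ioi
        (hint.mono_set Ioc_subset_Ioi_self) (hint.mono_set (Ioi_subset_Ioi zero_le_one)),
      Ioc_union_Ioi_eq_Ioi zero_le_one]
  have h1E : 1 - E ≠ 0 := by linarith
  rw [fractMean, ← hJ, div_eq_iff hb.ne']
  have : J = (b ^ 2 - E * (b ^ 2 + b)) / (1 - E) := by
    rw [eq_div_iff h1E]
    linarith
  rw [this]
  field_simp
  ring

lemma fractMean_le {b : ℝ} (hb : 0 < b) : fractMean b ≤ b := by
  have hE1 : Real.exp (-1 / b) < 1 := by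
    rw [Real.exp_lt_one_iff]
    exact div_neg_of_neg_of_pos (by norm_num) hb
  rw [fractMean_eq hb, sub_le_self_iff]
  have := Real.exp_pos (-1 / b)
  exact div_nonneg this.le (by linarith)

/-- The partial fraction expansion of the hyperbolic cotangent. -/
lemma hasSum_fractMean {b : ℝ} (hb : 0 < b) :
    HasSum (fun k : ℕ ↦ 2 * b / (1 + (2 * Real.pi * (k + 1) * b) ^ 2)) (1 / 2 - fractMean b) := by
  have hpi := Real.pi_pos
  have hsummable : Summable fun k : ℕ ↦ 2 * b / (1 + (2 * Real.pi * (k + 1) * b) ^ 2) := by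
    have h := ((summable_nat_add_iff 1).mpr (Real.summable_one_div_nat_pow.mpr one_lt_two)).mul_left
      (2 * b / (2 * Real.pi * b) ^ 2)
    refine Summable.of_nonneg_of_le (fun k ↦ by positivity) (fun k ↦ ?_) h
    push_cast
    rw [div_mul_div_comm, mul_one, ← mul_pow]
    gcongr
    nlinarith [show (2 * Real.pi * b * (k + 1)) = 2 * Real.pi * (k + 1) * b by ring]
  convert hsummable.hasSum using 1
  set y : ℝ := 1 / (2 * Real.pi * b) with hy
  have hy0 : 0 < y := by positivity
  have hz : (y * Complex.I : ℂ) ∈ Complex.integerComplement := by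
    rintro ⟨n, hn⟩
    have := congrArg Complex.im hn
    simp at this
    exact hy0.ne this
  have hcot := cot_series_rep' hz
  have hE : Complex.exp (2 * Real.pi * Complex.I * (y * Complex.I)) = (Real.exp (-1 / b) : ℝ) := by
    rw [Complex.ofReal_exp]
    congr 1
    rw [show (2 * Real.pi * Complex.I * (y * Complex.I) : ℂ) =
      2 * Real.pi * y * (Complex.I * Complex.I) by ring, Complex.I_mul_I, hy]
    have : (Real.pi : ℂ) ≠ 0 := by exact_mod_cast hpi.ne'
    have : (b : ℂ) ≠ 0 := by exact_mod_cast hb.ne'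
    push_cast
    field_simp
  have hE1 : Real.exp (-1 / b) < 1 := by
    rw [Real.exp_lt_one_iff]
    exact div_neg_of_neg_of_pos (by norm_num) hb
  rw [Complex.cot_pi_eq_exp_ratio, hE] at hcot
  set E := Real.exp (-1 / b) with hEdef
  have hterm (k : ℕ) : (1 / (y * Complex.I - (k + 1)) + 1 / (y * Complex.I + (k + 1)) : ℂ) =
      -Complex.I * (2 * Real.pi) * ((2 * b / (1 + (2 * Real.pi * (k + 1) * b) ^ 2) : ℝ) : ℂ) := by
    have e1 : (y * Complex.I - (k + 1) : ℂ) ≠ 0 := by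
      intro h
      have := congrArg Complex.im h
      simp at this
      exact hy0.ne' this
    have e2 : (y * Complex.I + (k + 1) : ℂ) ≠ 0 := by
      intro h
      have := congrArg Complex.im h
      simp at this
      exact hy0.ne' this
    have e3 : ((y * Complex.I - (k + 1)) * (y * Complex.I + (k + 1)) : ℂ) =
        -((y ^ 2 + (k + 1) ^ 2 : ℝ) : ℂ) := by
      push_cast
      linear_combination (y : ℂ) ^ 2 * Complex.I_sq
    have e4 : (2 * y / (y ^ 2 + (k + 1) ^ 2) : ℝ) =
        2 * Real.pi * (2 * b / (1 + (2 * Real.pi * (k + 1) * b) ^ 2)) := by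
      rw [hy]
      field_simp
    rw [one_div_add_one_div e1 e2, e3]
    have e5 : (-Complex.I * (2 * Real.pi) *
        ((2 * b / (1 + (2 * Real.pi * (k + 1) * b) ^ 2) : ℝ) : ℂ) : ℂ) =
        -Complex.I * ((2 * y / (y ^ 2 + (k + 1) ^ 2) : ℝ) : ℂ) := by
      rw [e4]
      push_cast
      ring
    rw [e5]
    push_cast
    rw [div_neg]
    ring
  simp_rw [hterm, tsum_mul_left, ← Complex.ofReal_tsum] at hcot
  set T := ∑' k : ℕ, 2 * b / (1 + (2 * Real.pi * (k + 1) * b) ^ 2) with hT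
  have h1E : 1 - E ≠ 0 := by linarith
  have h1E' : (1 - E : ℂ) ≠ 0 := by exact_mod_cast h1E
  have hcot2 : ((Real.pi * ((E + 1) / (1 - E)) - 1 / y : ℝ) : ℂ) = ((2 * Real.pi * T : ℝ) : ℂ) := by
    have hy' : (y : ℂ) ≠ 0 := by exact_mod_cast hy0.ne'
    have h := congrArg (fun z ↦ Complex.I * z) hcot
    have lhs : Complex.I * (Real.pi * ((E + 1) / (Complex.I * (1 - E))) - 1 / (y * Complex.I)) =
        Real.pi * ((E + 1) / (1 - E)) - 1 / y := by
      have := Complex.I_ne_zero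
      field_simp
    rw [lhs] at h
    push_cast
    rw [h]
    linear_combination (-(2 * Real.pi * T) : ℂ) * Complex.I_sq
  have hcot3 := Complex.ofReal_injective hcot2
  rw [fractMean_eq hb, ← hEdef]
  have hy1 : 1 / y = 2 * Real.pi * b := by rw [hy, one_div_one_div]
  rw [hy1] at hcot3
  have : T = (E + 1) / (1 - E) / 2 - b := by
    field_simp at hcot3 ⊢
    linarith
  rw [this]
  field_simp
  ring

/-! ### Fubini's theorem for the integral over `t` -/

lemma measurable_fractMean : Measurable fractMean := by
  have h : StronglyMeasurable fun b : ℝ ↦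
      ∫ t in Ioi (0 : ℝ), Int.fract t * Real.exp (-t / b) := by
    refine StronglyMeasurable.integral_prod_right'
      (f := fun p : ℝ × ℝ ↦ Int.fract p.2 * Real.exp (-p.2 / p.1)) ?_
    refine Measurable.stronglyMeasurable ?_
    exact (measurable_fract.comp measurable_snd).mul (by fun_prop)
  exact h.measurable.div measurable_id

/-- The sum of the series `∑ (μ(n)/n) e^{-t/(na)}`, in the form given by summation by parts. -/
noncomputable def mobiusExpSum (a t : ℝ) : ℝ :=
  -∫ x in Ioi (1 : ℝ), Real.exp (-t / (x * a)) * (t / (a * x ^ 2)) * mobiusSum x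

lemma tendsto_mobiusExpPartialSum {a t : ℝ} (ha : 0 < a) (ht : 0 < t) :
    Tendsto (fun N : ℕ ↦ mobiusExpPartialSum a t N) atTop (𝓝 (mobiusExpSum a t)) := by
  have hder (x : ℝ) (hx : 1 ≤ x) : HasDerivAt (fun x : ℝ ↦ Real.exp (-t / (x * a)))
      (Real.exp (-t / (x * a)) * (t / (a * x ^ 2))) x := by
    have hx0 : x ≠ 0 := by linarith
    have h1 : HasDerivAt (fun x : ℝ ↦ -t / (x * a)) ((0 * (x * a) - -t * (1 * a)) / (x * a) ^ 2) x :=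
      (hasDerivAt_const x (-t)).div ((hasDerivAt_id x).mul_const a) (mul_ne_zero hx0 ha.ne')
    convert! h1.exp using 2
    field_simp
    ring
  have hle (x : ℝ) (hx : 1 ≤ x) : Real.exp (-t / (x * a)) ≤ 1 := by
    rw [Real.exp_le_one_iff]
    exact div_nonpos_of_nonpos_of_nonneg (by linarith) (by positivity)
  have h := tendsto_sum_moebius_mul (g := fun x ↦ Real.exp (-t / (x * a))) (B := 1) (C := t / a)
    (fun x hx ↦ (hder x hx).differentiableAt) ?_ (fun x hx ↦ ?_) (fun x hx ↦ ?_)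
  · rw [mobiusExpSum]
    convert! h using 3
    refine setIntegral_congr_fun measurableSet_Ioi fun x hx ↦ ?_
    simp only [(hder x (mem_Ioi.mp hx).le).deriv]
  · refine ContinuousOn.congr (f := fun x ↦ Real.exp (-t / (x * a)) * (t / (a * x ^ 2))) ?_
      fun x hx ↦ (hder x hx).deriv
    have hne (x : ℝ) (hx : x ∈ Ici (1 : ℝ)) : x ≠ 0 := by
      have := mem_Ici.mp hx
      linarith
    refine ContinuousOn.mul (ContinuousOn.rexp (ContinuousOn.div (by fun_prop) (by fun_prop) ?_))
      (ContinuousOn.div (by fun_prop) (by fun_prop) ?_)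
    · exact fun x hx ↦ mul_ne_zero (hne x hx) ha.ne'
    · exact fun x hx ↦ mul_ne_zero ha.ne' (pow_ne_zero 2 (hne x hx))
  · rw [abs_of_pos (Real.exp_pos _)]
    exact hle x hx
  · rw [(hder x hx).deriv, abs_of_nonneg (by positivity), div_div]
    calc _ ≤ 1 * (t / (a * x ^ 2)) := by gcongr; exact hle x hx
      _ ≤ t / (a * x) := by
        rw [one_mul]
        gcongr
        nlinarith

/-- Interchanging the integrations over `t` and `x`. -/
lemma integral_fract_mul_mobiusExpSum {a : ℝ} (ha : 0 < a) :
    IntegrableOn (fun t : ℝ ↦ Int.fract t / t * mobiusExpSum a t) (Ioi 0) ∧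
      ∫ t in Ioi (0 : ℝ), Int.fract t / t * mobiusExpSum a t =
        -∫ x in Ioi (1 : ℝ), mobiusSum x / x * fractMean (x * a) := by
  set K : ℝ → ℝ → ℝ := fun t x ↦
    Int.fract t * Real.exp (-t / (x * a)) * (mobiusSum x / (a * x ^ 2)) with hK
  have hmeas : Measurable (Function.uncurry K) := by
    have h1 : Measurable fun p : ℝ × ℝ ↦ Int.fract p.1 := measurable_fract.comp measurable_fst
    have h2 : Measurable fun p : ℝ × ℝ ↦ mobiusSum p.2 := measurable_mobiusSum.comp measurable_snd
    simp only [hK, Function.uncurry_def]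
    exact (h1.mul (by fun_prop)).mul (h2.div (by fun_prop))
  have hx1 : ∀ᵐ x ∂volume.restrict (Ioi (1 : ℝ)), 1 < x := ae_restrict_mem measurableSet_Ioi
  have hnorm (x : ℝ) (hx : 1 < x) : ∫ t in Ioi (0 : ℝ), ‖K t x‖ =
      |mobiusSum x| / x * fractMean (x * a) := by
    have hx0 : 0 < x := by linarith
    have : ∀ t, ‖K t x‖ = Int.fract t * Real.exp (-t / (x * a)) * (|mobiusSum x| / (a * x ^ 2)) := by
      intro t
      simp only [hK, norm_mul, norm_div, Real.norm_eq_abs]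
      rw [abs_of_nonneg (Int.fract_nonneg t), abs_of_pos (Real.exp_pos _), abs_of_pos ha,
        abs_of_nonneg (by positivity : 0 ≤ x ^ 2)]
    simp_rw [this]
    rw [integral_mul_const, fractMean]
    field_simp
  have hint : Integrable (Function.uncurry K)
      ((volume.restrict (Ioi (0 : ℝ))).prod (volume.restrict (Ioi (1 : ℝ)))) := by
    rw [integrable_prod_iff' hmeas.aestronglyMeasurable]
    constructor
    · filter_upwards [hx1] with x hx
      exact (integrableOn_fract_mul_exp (b := x * a) (by positivity)).mul_const
        (mobiusSum x / (a * x ^ 2))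
    · have h0 : IntegrableOn (fun x ↦ |mobiusSum x| / x) (Ioi 1) :=
        integrableOn_abs_mobiusSum_div.mono_set (Ioi_subset_Ioi zero_le_one)
      have hm : Measurable fun x ↦ |mobiusSum x| / x * fractMean (x * a) := by
        have h1 := measurable_mobiusSum
        have h2 := measurable_fractMean
        exact ((measurable_abs.comp h1).div measurable_id).mul (h2.comp (by fun_prop))
      have h1 : Integrable (fun x ↦ |mobiusSum x| / x * fractMean (x * a))
          (volume.restrict (Ioi 1)) := by
        refine Integrable.mono' h0 hm.aestronglyMeasurable ?_
        filter_upwards [hx1] with x hx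
        have hxa : 0 < x * a := by positivity
        have : 0 ≤ |mobiusSum x| / x := by positivity
        rw [norm_mul, Real.norm_of_nonneg this, Real.norm_of_nonneg (fractMean_nonneg hxa)]
        exact mul_le_of_le_one_right this (fractMean_le_one hxa)
      refine h1.congr ?_
      filter_upwards [hx1] with x hx
      exact (hnorm x hx).symm
  have hF (t : ℝ) (ht : 0 < t) : Int.fract t / t * mobiusExpSum a t =
      -∫ x in Ioi (1 : ℝ), K t x := by
    rw [mobiusExpSum, mul_neg, ← integral_const_mul]
    congr 1
    refine setIntegral_congr_fun measurableSet_Ioi fun x hx ↦ ?_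
    simp only [hK]
    field_simp
  constructor
  · refine IntegrableOn.congr_fun (f := fun t ↦ -∫ x in Ioi (1 : ℝ), K t x)
      hint.integral_prod_left.neg (fun t ht ↦ (hF t ht).symm) measurableSet_Ioi
  · rw [setIntegral_congr_fun measurableSet_Ioi fun t ht ↦ hF t ht, integral_neg,
      integral_integral_swap hint]
    congr 1
    refine setIntegral_congr_fun measurableSet_Ioi fun x hx ↦ ?_
    have hx0 : 0 < x := by linarith [mem_Ioi.mp hx]
    simp only [hK]
    rw [integral_mul_const, fractMean]
    field_simp

lemma hasSum_integral_mobiusSum {a : ℝ} (ha : 0 < a) :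
    HasSum (fun k : ℕ ↦ ∫ x in Ioi (1 : ℝ), mobiusSum x / x *
        (2 * (x * a) / (1 + (2 * Real.pi * (k + 1) * (x * a)) ^ 2)))
      (∫ x in Ioi (1 : ℝ), mobiusSum x / x * (1 / 2 - fractMean (x * a))) := by
  have hx1 : ∀ᵐ x ∂volume.restrict (Ioi (1 : ℝ)), 1 < x := ae_restrict_mem measurableSet_Ioi
  have h0 : IntegrableOn (fun x ↦ |mobiusSum x| / x) (Ioi 1) :=
    integrableOn_abs_mobiusSum_div.mono_set (Ioi_subset_Ioi zero_le_one)
  set F : ℕ → ℝ → ℝ := fun k x ↦ mobiusSum x / x *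
        (2 * (x * a) / (1 + (2 * Real.pi * (k + 1) * (x * a)) ^ 2)) with hF
  have hbound (k : ℕ) (x : ℝ) (hx : 1 < x) :
      ‖F k x‖ ≤ |mobiusSum x| / x * (1 / a * (1 / ((k : ℝ) + 1) ^ 2)) := by
    have hx0 : 0 < x := by linarith
    have hpi := Real.pi_gt_three
    simp only [hF, norm_mul, norm_div, Real.norm_eq_abs]
    rw [abs_of_pos hx0, abs_of_pos (two_pos : (0 : ℝ) < 2), abs_of_pos ha,
      abs_of_pos (by positivity : 0 < 1 + (2 * Real.pi * (k + 1) * (x * a)) ^ 2)]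
    gcongr
    rw [one_div_mul_one_div, div_le_div_iff₀ (by positivity) (by positivity), one_mul]
    calc 2 * (x * a) * (a * ((k : ℝ) + 1) ^ 2) = ((k + 1) * a) ^ 2 * (2 * x) := by ring
      _ ≤ ((k + 1) * a) ^ 2 * (2 * Real.pi * x) ^ 2 := by
          gcongr
          have h1 : 2 * x ≤ 2 * Real.pi * x := by nlinarith
          nlinarith
      _ = (2 * Real.pi * (k + 1) * (x * a)) ^ 2 := by ring
      _ ≤ _ := by linarith
  have hmeas (k : ℕ) : Measurable (F k) := by
    have := measurable_mobiusSum
    fun_prop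
  have hint (k : ℕ) : Integrable (F k) (volume.restrict (Ioi 1)) := by
    refine Integrable.mono' (h0.mul_const (1 / a * (1 / ((k : ℝ) + 1) ^ 2)))
      (hmeas k).aestronglyMeasurable ?_
    filter_upwards [hx1] with x hx using hbound k x hx
  have hsum : Summable fun k ↦ ∫ x in Ioi (1 : ℝ), ‖F k x‖ := by
    have h := (((summable_nat_add_iff 1).mpr
      (Real.summable_one_div_nat_pow.mpr one_lt_two)).mul_left (1 / a)).mul_left
        (∫ x in Ioi (1 : ℝ), |mobiusSum x| / x)
    refine Summable.of_nonneg_of_le (fun k ↦ integral_nonneg fun x ↦ norm_nonneg _) (fun k ↦ ?_) h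
    push_cast
    rw [← integral_mul_const]
    refine integral_mono_ae (hint k).norm (h0.mul_const _) ?_
    filter_upwards [hx1] with x hx using hbound k x hx
  convert! hasSum_integral_of_summable_integral_norm hint hsum using 1
  refine setIntegral_congr_fun measurableSet_Ioi fun x hx ↦ ?_
  have hxa : 0 < x * a := mul_pos (by linarith [mem_Ioi.mp hx]) ha
  simp only [hF]
  rw [tsum_mul_left, (hasSum_fractMean hxa).tsum_eq]

/-! ### Evaluation by Möbius inversion -/

/-- Möbius inversion: `∑_k ∑_n μ(n) h(kn) = ∑_N h(N) ∑_{n ∣ N} μ(n) = h(1)`. -/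
lemma tsum_tsum_moebius_mul {h : ℕ → ℝ} {C : ℝ} (hh : ∀ N, |h N| ≤ C / (N : ℝ) ^ 2) :
    ∑' k : ℕ, ∑' n : ℕ, ((ArithmeticFunction.moebius (n + 1) : ℤ) : ℝ) * h ((k + 1) * (n + 1)) =
      h 1 := by
  set f : ℕ+ × ℕ+ → ℝ := fun p ↦ ((ArithmeticFunction.moebius p.2 : ℤ) : ℝ) * h (p.1 * p.2)
    with hf
  have hsum : Summable f := by
    have h2 : Summable fun n : ℕ+ ↦ 1 / ((n : ℕ) : ℝ) ^ 2 :=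
      (Real.summable_one_div_nat_pow.mpr one_lt_two).comp_injective PNat.coe_injective
    have h3 := (h2.mul_of_nonneg h2 (fun _ ↦ by positivity) (fun _ ↦ by positivity)).mul_left C
    refine Summable.of_norm_bounded h3 fun p ↦ ?_
    have h4 : |((ArithmeticFunction.moebius p.2 : ℤ) : ℝ)| ≤ 1 := by
      exact_mod_cast ArithmeticFunction.abs_moebius_le_one
    rw [hf, norm_mul, Real.norm_eq_abs, Real.norm_eq_abs]
    calc _ ≤ 1 * (C / ((p.1 * p.2 : ℕ) : ℝ) ^ 2) := by gcongr; exact hh _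
      _ = _ := by push_cast; field_simp
  have hleft : ∑' k : ℕ, ∑' n : ℕ,
      ((ArithmeticFunction.moebius (n + 1) : ℤ) : ℝ) * h ((k + 1) * (n + 1)) = ∑' p, f p := by
    rw [hsum.tsum_prod, ← tsum_pnat_eq_tsum_succ
      (f := fun k ↦ ∑' n : ℕ, ((ArithmeticFunction.moebius (n + 1) : ℤ) : ℝ) * h (k * (n + 1)))]
    refine tsum_congr fun k ↦ ?_
    rw [← tsum_pnat_eq_tsum_succ
      (f := fun n ↦ ((ArithmeticFunction.moebius n : ℤ) : ℝ) * h (k * n))]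
  rw [hleft, ← sigmaAntidiagonalEquivProd.tsum_eq,
    Summable.tsum_sigma (f := fun p ↦ f (sigmaAntidiagonalEquivProd p))
      (sigmaAntidiagonalEquivProd.summable_iff.mpr hsum)]
  have hfib (N : ℕ+) : ∑' p : (N : ℕ).divisorsAntidiagonal,
      f (sigmaAntidiagonalEquivProd ⟨N, p⟩) = if N = 1 then h 1 else 0 := by
    have h1 (p : (N : ℕ).divisorsAntidiagonal) : f (sigmaAntidiagonalEquivProd ⟨N, p⟩) =
        ((ArithmeticFunction.moebius p.1.2 : ℤ) : ℝ) * h N :=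
      congrArg (fun M ↦ ((ArithmeticFunction.moebius p.1.2 : ℤ) : ℝ) * h M)
        (Nat.mem_divisorsAntidiagonal.mp p.2).1
    simp_rw [h1]
    rw [tsum_fintype, ← Finset.sum_mul,
      Finset.sum_coe_sort ((N : ℕ).divisorsAntidiagonal)
        (fun p : ℕ × ℕ ↦ ((ArithmeticFunction.moebius p.2 : ℤ) : ℝ)),
      Nat.sum_divisorsAntidiagonal' (f := fun _ y ↦ ((ArithmeticFunction.moebius y : ℤ) : ℝ)),
      ← Int.cast_sum, ← ArithmeticFunction.coe_mul_zeta_apply,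
      ArithmeticFunction.moebius_mul_coe_zeta, ArithmeticFunction.one_apply]
    by_cases hN : N = 1
    · simp [hN]
    · have : (N : ℕ) ≠ 1 := fun h' ↦ hN (PNat.coe_injective (by simpa using h'))
      simp [hN, this]
  simp_rw [hfib]
  rw [tsum_ite_eq]

lemma arctan_le_self {x : ℝ} (hx : 0 ≤ x) : Real.arctan x ≤ x := by
  have h := Convex.norm_image_sub_le_of_norm_deriv_le (𝕜 := ℝ) (f := Real.arctan) (C := 1)
    (fun y _ ↦ Real.differentiableAt_arctan y) (fun y _ ↦ ?_) convex_univ (mem_univ 0) (mem_univ x)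
  · rw [Real.arctan_zero, sub_zero, sub_zero, one_mul, Real.norm_of_nonneg hx] at h
    exact (le_abs_self _).trans h
  · rw [Real.deriv_arctan, Real.norm_of_nonneg (by positivity), div_le_one (by positivity)]
    linarith [sq_nonneg y]

/-- Summation by parts for `g(x) = (πk)⁻¹ arctan(1/(2πkax))`, whose derivative is
`-2a/(1 + (2πkax)²)`. -/
lemma integral_mobiusSum_mul_eq_tsum {a : ℝ} (ha : 0 < a) (k : ℕ) :
    ∫ x in Ioi (1 : ℝ), mobiusSum x / x *
        (2 * (x * a) / (1 + (2 * Real.pi * (k + 1) * (x * a)) ^ 2)) =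
      ∑' n : ℕ, ((ArithmeticFunction.moebius (n + 1) : ℤ) : ℝ) *
        (1 / (Real.pi * ((k + 1) * (n + 1) : ℕ)) *
          Real.arctan (1 / (2 * Real.pi * a * ((k + 1) * (n + 1) : ℕ)))) := by
  have hpi := Real.pi_pos
  set c : ℝ := 2 * Real.pi * (k + 1) * a with hc
  have hc0 : 0 < c := by positivity
  set g : ℝ → ℝ := fun x ↦ 1 / (Real.pi * (k + 1)) * Real.arctan (1 / (c * x)) with hg
  have hder (x : ℝ) (hx : 1 ≤ x) : HasDerivAt g (-(2 * a / (1 + (c * x) ^ 2))) x := by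
    have hx0 : x ≠ 0 := by linarith
    have h1 : HasDerivAt (fun x : ℝ ↦ 1 / (c * x))
        ((0 * (c * x) - 1 * (c * 1)) / (c * x) ^ 2) x :=
      (hasDerivAt_const x (1 : ℝ)).div ((hasDerivAt_id x).const_mul c) (mul_ne_zero hc0.ne' hx0)
    refine (h1.arctan.const_mul (1 / (Real.pi * (k + 1)))).congr_deriv ?_
    have h2 : (1 + (1 / (c * x)) ^ 2) = (1 + (c * x) ^ 2) / (c * x) ^ 2 := by
      field_simp
      ring
    have h3 : 0 < 1 + (c * x) ^ 2 := by positivity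
    rw [h2, hc]
    rw [hc] at h3
    field_simp
    ring
  have h := tendsto_sum_moebius_mul (g := g) (B := 1 / (Real.pi * (k + 1)) * (Real.pi / 2))
    (C := 2 * a / c) (fun x hx ↦ (hder x hx).differentiableAt) ?_ (fun x hx ↦ ?_) (fun x hx ↦ ?_)
  · have hI : -∫ x in Ioi (1 : ℝ), deriv g x * mobiusSum x = ∫ x in Ioi (1 : ℝ), mobiusSum x / x *
        (2 * (x * a) / (1 + (2 * Real.pi * (k + 1) * (x * a)) ^ 2)) := by
      rw [← integral_neg]
      refine setIntegral_congr_fun measurableSet_Ioi fun x hx ↦ ?_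
      have hx0 : 0 < x := by linarith [mem_Ioi.mp hx]
      rw [(hder x (mem_Ioi.mp hx).le).deriv,
        show 2 * Real.pi * (k + 1) * (x * a) = c * x by rw [hc]; ring]
      field_simp
    rw [hI] at h
    refine tendsto_nhds_unique h ?_
    set f : ℕ → ℝ := fun n ↦ ((ArithmeticFunction.moebius n : ℤ) : ℝ) / n * g n with hf
    have hterm (n : ℕ) : ((ArithmeticFunction.moebius (n + 1) : ℤ) : ℝ) *
        (1 / (Real.pi * ((k + 1) * (n + 1) : ℕ)) *
          Real.arctan (1 / (2 * Real.pi * a * ((k + 1) * (n + 1) : ℕ)))) = f (n + 1) := by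
      simp only [hf, hg, hc]
      push_cast
      rw [show 2 * Real.pi * a * (((k : ℝ) + 1) * (n + 1)) =
        2 * Real.pi * (k + 1) * a * (n + 1) by ring]
      field_simp
    simp_rw [hterm]
    have hsummable : Summable fun n : ℕ ↦ f (n + 1) := by
      have h2 := ((summable_nat_add_iff 1).mpr
        (Real.summable_one_div_nat_pow.mpr one_lt_two)).mul_left (1 / (Real.pi * (k + 1)) * (1 / c))
      refine Summable.of_norm_bounded h2 fun n ↦ ?_
      have h3 := abs_moebius_div_le (n + 1)
      have h4 : |g ((n + 1 : ℕ) : ℝ)| ≤ 1 / (Real.pi * (k + 1)) * (1 / (c * (n + 1 : ℕ))) := by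
        have h5 : 0 ≤ Real.arctan (1 / (c * (n + 1 : ℕ))) :=
          Real.arctan_nonneg.mpr (by positivity)
        simp only [hg]
        rw [abs_of_nonneg (by positivity)]
        gcongr
        exact arctan_le_self (by positivity)
      simp only [hf]
      rw [norm_mul, Real.norm_eq_abs, Real.norm_eq_abs]
      calc _ ≤ 1 / ((n + 1 : ℕ) : ℝ) * (1 / (Real.pi * (k + 1)) * (1 / (c * (n + 1 : ℕ)))) := by
            gcongr
        _ = _ := by field_simp
    refine hsummable.hasSum.tendsto_sum_nat.congr fun N ↦ ?_
    rw [Finset.range_eq_Ico, Finset.sum_Ico_add' f 0 N 1, zero_add,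
      show Finset.Ico 1 (N + 1) = Finset.Icc 1 N from rfl]
  · refine ContinuousOn.congr (f := fun x ↦ -(2 * a / (1 + (c * x) ^ 2))) ?_
      fun x hx ↦ (hder x hx).deriv
    refine Continuous.continuousOn (Continuous.neg (Continuous.div (by fun_prop) (by fun_prop) ?_))
    intro x
    positivity
  · simp only [hg]
    rw [abs_mul, abs_of_pos (by positivity : 0 < 1 / (Real.pi * ((k : ℝ) + 1)))]
    gcongr
    exact (abs_lt.mpr ⟨Real.neg_pi_div_two_lt_arctan _, Real.arctan_lt_pi_div_two _⟩).le
  · have hx0 : 0 < x := by linarith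
    rw [(hder x hx).deriv, abs_neg, abs_of_pos (by positivity), div_div]
    gcongr
    nlinarith [sq_nonneg (c * x - 1)]

lemma integral_mobiusSum_mul_half_sub {a : ℝ} (ha : 0 < a) :
    ∫ x in Ioi (1 : ℝ), mobiusSum x / x * (1 / 2 - fractMean (x * a)) =
      1 / Real.pi * Real.arctan (1 / (2 * Real.pi * a)) := by
  have hpi := Real.pi_pos
  rw [← (hasSum_integral_mobiusSum ha).tsum_eq]
  simp_rw [integral_mobiusSum_mul_eq_tsum ha]
  rw [tsum_tsum_moebius_mul (C := 1 / Real.pi * (1 / (2 * Real.pi * a)))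
    (h := fun N : ℕ ↦ 1 / (Real.pi * N) * Real.arctan (1 / (2 * Real.pi * a * N)))]
  · simp
  · intro N
    have h5 : 0 ≤ Real.arctan (1 / (2 * Real.pi * a * N)) :=
      Real.arctan_nonneg.mpr (by positivity)
    rw [abs_of_nonneg (by positivity)]
    calc _ ≤ 1 / (Real.pi * N) * (1 / (2 * Real.pi * a * N)) := by
          gcongr
          exact arctan_le_self (by positivity)
      _ = _ := by
          rcases N.eq_zero_or_pos with rfl | hN
          · simp
          · field_simp

lemma integral_mobiusSum_mul_fractMean_eq {a : ℝ} (ha : 0 < a) :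
    ∫ x in Ioi (1 : ℝ), mobiusSum x / x * fractMean (x * a) =
      (∫ x in Ioi (1 : ℝ), mobiusSum x / x) * (1 / 2) -
        1 / Real.pi * Real.arctan (1 / (2 * Real.pi * a)) := by
  rw [← integral_mobiusSum_mul_half_sub ha, ← integral_mul_const, ← integral_sub]
  · congr 1
    ext x
    ring
  · exact (integrableOn_mobiusSum_div.mono_set (Ioi_subset_Ioi zero_le_one)).mul_const _
  · have h := measurable_mobiusSum
    have h' := measurable_fractMean
    refine Integrable.mono' (integrableOn_abs_mobiusSum_div.mono_set (Ioi_subset_Ioi zero_le_one))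
      ((h.div measurable_id).mul
        (measurable_const.sub (h'.comp (by fun_prop)))).aestronglyMeasurable ?_
    filter_upwards [ae_restrict_mem measurableSet_Ioi] with x hx
    have hx0 : 0 < x := by linarith [mem_Ioi.mp hx]
    have hxa : 0 < x * a := by positivity
    have h1 := fractMean_nonneg hxa
    have h2 := fractMean_le_one hxa
    rw [norm_mul, norm_div, Real.norm_eq_abs, Real.norm_eq_abs, Real.norm_eq_abs, abs_of_pos hx0]
    refine mul_le_of_le_one_right (by positivity) ?_
    rw [abs_le]
    constructor <;> linarith

/-- Letting `a → 0⁺` evaluates the constant: `∫₁^∞ m(x)/x dx = -∑ μ(n) log n / n = 1`. -/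
lemma integral_mobiusSum_div : ∫ x in Ioi (1 : ℝ), mobiusSum x / x = 1 := by
  have hpi := Real.pi_pos
  have h1 : Tendsto (fun a : ℝ ↦ ∫ x in Ioi (1 : ℝ), mobiusSum x / x * fractMean (x * a))
      (𝓝[>] 0) (𝓝 (∫ x in Ioi (1 : ℝ), 0)) := by
    refine tendsto_integral_filter_of_dominated_convergence (fun x ↦ |mobiusSum x| / x) ?_ ?_
      (integrableOn_abs_mobiusSum_div.mono_set (Ioi_subset_Ioi zero_le_one)) ?_
    · refine Eventually.of_forall fun a ↦ Measurable.aestronglyMeasurable ?_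
      have h := measurable_mobiusSum
      have h' := measurable_fractMean
      exact (h.div measurable_id).mul (h'.comp (by fun_prop))
    · filter_upwards [self_mem_nhdsWithin] with a ha
      filter_upwards [ae_restrict_mem measurableSet_Ioi] with x hx
      have hx0 : 0 < x := by linarith [mem_Ioi.mp hx]
      have hxa : 0 < x * a := mul_pos hx0 ha
      rw [norm_mul, norm_div, Real.norm_eq_abs, Real.norm_eq_abs, Real.norm_eq_abs,
        abs_of_pos hx0, abs_of_nonneg (fractMean_nonneg hxa)]
      exact mul_le_of_le_one_right (by positivity) (fractMean_le_one hxa)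
    · filter_upwards [ae_restrict_mem measurableSet_Ioi] with x hx
      have hx0 : 0 < x := by linarith [mem_Ioi.mp hx]
      have h2 : Tendsto (fun a : ℝ ↦ fractMean (x * a)) (𝓝[>] 0) (𝓝 0) := by
        have h3 : Tendsto (fun a : ℝ ↦ x * a) (𝓝[>] 0) (𝓝 0) := by
          have : Tendsto (fun a : ℝ ↦ x * a) (𝓝 0) (𝓝 (x * 0)) :=
            (continuous_const.mul continuous_id).tendsto 0
          rw [mul_zero] at this
          exact this.mono_left nhdsWithin_le_nhds
        refine tendsto_of_tendsto_of_tendsto_of_le_of_le' tendsto_const_nhds h3 ?_ ?_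
        · filter_upwards [self_mem_nhdsWithin] with a ha using fractMean_nonneg (mul_pos hx0 ha)
        · filter_upwards [self_mem_nhdsWithin] with a ha using fractMean_le (mul_pos hx0 ha)
      simpa using h2.const_mul (mobiusSum x / x)
  have h2 : Tendsto (fun a : ℝ ↦ Real.arctan (1 / (2 * Real.pi * a))) (𝓝[>] 0)
      (𝓝 (Real.pi / 2)) := by
    have h3 : Tendsto (fun a : ℝ ↦ 1 / (2 * Real.pi * a)) (𝓝[>] 0) atTop := by
      have := tendsto_inv_nhdsGT_zero (𝕜 := ℝ) |>.const_mul_atTop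
        (show 0 < 1 / (2 * Real.pi) by positivity)
      refine this.congr fun a ↦ ?_
      field_simp
    exact (Real.tendsto_arctan_atTop.mono_right nhdsWithin_le_nhds).comp h3
  have h4 := (h2.const_mul (1 / Real.pi)).const_sub ((∫ x in Ioi (1 : ℝ), mobiusSum x / x) * (1 / 2))
  have h5 := tendsto_nhds_unique (h4.congr' ?_) h1
  · rw [integral_zero] at h5
    have : 1 / Real.pi * (Real.pi / 2) = 1 / 2 := by field_simp
    linarith
  · filter_upwards [self_mem_nhdsWithin] with a ha
    exact (integral_mobiusSum_mul_fractMean_eq ha).symm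

/-! ### The sine integral -/

lemma integral_sin_mul_exp_neg (v : ℝ) :
    ∫ x in Ioi (0 : ℝ), Real.sin (x * v) * Real.exp (-x) = v / (1 + v ^ 2) := by
  have h1 : (0 : ℝ) < 1 + v ^ 2 := by positivity
  have hder (x : ℝ) : HasDerivAt
      (fun x ↦ -(Real.sin (x * v) + v * Real.cos (x * v)) / (1 + v ^ 2) * Real.exp (-x))
      (Real.sin (x * v) * Real.exp (-x)) x := by
    have h2 : HasDerivAt (fun x : ℝ ↦ x * v) (1 * v) x := (hasDerivAt_id x).mul_const v
    have h3 := ((h2.sin.add (h2.cos.const_mul v)).neg.div_const (1 + v ^ 2)).mul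
      (hasDerivAt_neg x).exp
    refine h3.congr_deriv ?_
    simp only [Pi.neg_apply, Pi.add_apply]
    field_simp
    ring
  have hint : IntegrableOn (fun x ↦ Real.sin (x * v) * Real.exp (-x)) (Ioi 0) := by
    refine Integrable.mono' (integrableOn_exp_neg_Ioi 0)
      (by fun_prop) (Eventually.of_forall fun x ↦ ?_)
    rw [norm_mul, Real.norm_eq_abs, Real.norm_of_nonneg (Real.exp_pos _).le]
    exact mul_le_of_le_one_left (Real.exp_pos _).le (Real.abs_sin_le_one _)
  have hlim : Tendsto
      (fun x ↦ -(Real.sin (x * v) + v * Real.cos (x * v)) / (1 + v ^ 2) * Real.exp (-x))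
      atTop (𝓝 0) := by
    refine bdd_le_mul_tendsto_zero' ((1 + |v|) / (1 + v ^ 2)) (Eventually.of_forall fun x ↦ ?_)
      (Real.tendsto_exp_neg_atTop_nhds_zero)
    rw [abs_div, abs_neg, abs_of_pos h1]
    gcongr
    refine (abs_add_le _ _).trans (add_le_add (Real.abs_sin_le_one _) ?_)
    rw [abs_mul]
    exact mul_le_of_le_one_right (abs_nonneg _) (Real.abs_cos_le_one _)
  rw [integral_Ioi_of_hasDerivAt_of_tendsto' (fun x _ ↦ hder x) hint hlim]
  simp
  ring

lemma sineIntegral_mul {c x : ℝ} (hx : 0 < x) :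
    sineIntegral (c * x) = ∫ v in (0 : ℝ)..c, Real.sin (x * v) / v := by
  have h := intervalIntegral.mul_integral_comp_mul_left (a := 0) (b := c)
    (f := fun u : ℝ ↦ Real.sin u / u) x
  rw [mul_zero, mul_comm x c] at h
  rw [sineIntegral, ← h, ← intervalIntegral.integral_const_mul]
  refine intervalIntegral.integral_congr fun v _ ↦ ?_
  rw [mul_div_assoc', mul_div_mul_left _ _ hx.ne']

/-- The Laplace transform of the sine integral is an arctangent. -/
lemma integral_sineIntegral_mul_exp_neg {c : ℝ} (hc : 0 < c) :
    IntegrableOn (fun x ↦ sineIntegral (c * x) * Real.exp (-x)) (Ioi 0) ∧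
      ∫ x in Ioi (0 : ℝ), sineIntegral (c * x) * Real.exp (-x) = Real.arctan c := by
  set K : ℝ → ℝ → ℝ := fun x v ↦ Real.sin (x * v) / v * Real.exp (-x) with hK
  have hmeas : Measurable (Function.uncurry K) := by
    simp only [hK, Function.uncurry_def]
    fun_prop
  have hx : IntegrableOn (fun x : ℝ ↦ x * Real.exp (-x)) (Ioi 0) := by
    refine (Real.GammaIntegral_convergent (s := 2) two_pos).congr_fun (fun x hx ↦ ?_)
      measurableSet_Ioi
    simp only
    rw [show (2 : ℝ) - 1 = 1 by norm_num, Real.rpow_one, mul_comm]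
  have hint : Integrable (Function.uncurry K)
      ((volume.restrict (Ioi (0 : ℝ))).prod (volume.restrict (Ioc 0 c))) := by
    have h1 : Integrable (fun _ : ℝ ↦ (1 : ℝ)) (volume.restrict (Ioc 0 c)) := integrable_const _
    refine (hx.norm.mul_prod h1).mono' hmeas.aestronglyMeasurable
      (Eventually.of_forall fun p ↦ ?_)
    simp only [hK, Function.uncurry_def, norm_mul, norm_div, mul_one, Real.norm_eq_abs]
    gcongr
    rcases eq_or_ne p.2 0 with h0 | h0
    · simp [h0]
    · rw [div_le_iff₀ (abs_pos.mpr h0), ← abs_mul]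
      exact Real.abs_sin_le_abs
  have hF (x : ℝ) (hx : x ∈ Ioi (0 : ℝ)) : sineIntegral (c * x) * Real.exp (-x) =
      ∫ v in Ioc 0 c, K x v := by
    rw [sineIntegral_mul hx, intervalIntegral.integral_of_le hc.le, ← integral_mul_const]
  constructor
  · exact IntegrableOn.congr_fun (f := fun x ↦ ∫ v in Ioc 0 c, K x v)
      hint.integral_prod_left (fun x hx ↦ (hF x hx).symm) measurableSet_Ioi
  · rw [setIntegral_congr_fun measurableSet_Ioi hF, integral_integral_swap hint]
    have h2 : ∫ v in Ioc 0 c, ∫ x in Ioi (0 : ℝ), K x v = ∫ v in Ioc 0 c, (1 + v ^ 2)⁻¹ := by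
      refine setIntegral_congr_fun measurableSet_Ioc fun v hv ↦ ?_
      have hv0 : v ≠ 0 := hv.1.ne'
      have h3 (x : ℝ) : K x v = v⁻¹ * (Real.sin (x * v) * Real.exp (-x)) := by
        simp only [hK]
        ring
      simp_rw [h3]
      rw [integral_const_mul, integral_sin_mul_exp_neg]
      field_simp
    rw [h2, ← intervalIntegral.integral_of_le hc.le, integral_inv_one_add_sq, Real.arctan_zero,
      sub_zero]

end MobiusExp

theorem theorem4p1 (a : ℝ) (ha : 0 < a) :
    ∃ Δ : ℝ → ℝ,
      (∀ t : ℝ, 0 < t →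
        Filter.Tendsto (fun N : ℕ => mobiusExpPartialSum a t N) Filter.atTop (nhds (Δ t))) ∧
      MeasureTheory.IntegrableOn (fun t : ℝ => Int.fract t / t * Δ t) (Set.Ioi 0) ∧
      MeasureTheory.IntegrableOn
        (fun x : ℝ => sineIntegral (x / (2 * Real.pi * a)) * Real.exp (-x)) (Set.Ioi 0) ∧
      ∫ t in Set.Ioi (0 : ℝ), Int.fract t / t * Δ t =
        -(1 / 2) + 1 / Real.pi *
          ∫ x in Set.Ioi (0 : ℝ), sineIntegral (x / (2 * Real.pi * a)) * Real.exp (-x) := by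
  have hpi := Real.pi_pos
  obtain ⟨h1, h2⟩ := MobiusExp.integral_fract_mul_mobiusExpSum ha
  obtain ⟨h3, h4⟩ := MobiusExp.integral_sineIntegral_mul_exp_neg
    (c := 1 / (2 * Real.pi * a)) (by positivity)
  simp_rw [one_div_mul_eq_div] at h3 h4
  refine ⟨MobiusExp.mobiusExpSum a, fun t ht ↦ MobiusExp.tendsto_mobiusExpPartialSum ha ht, h1,
    h3, ?_⟩
  rw [h2, h4, MobiusExp.integral_mobiusSum_mul_fractMean_eq ha, MobiusExp.integral_mobiusSum_div]
  ring
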